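/- Throughout, for a join-semilattice (or lattice) $A$ with zero, $A^-=A\setminus\{0\}$, and the tensor product $A\otimes B$ of two join-semilattices $A$, $B$ with zero is the free join-semilattice with zero generated by the set $A^-\times B^-$ subject to the relations $\langle a,b_0\rangle\vee\langle a,b_1\rangle=\langle a,b_0\vee b_1\rangle$ and $\langle a_0,b\rangle\vee\langle a_1,b\rangle=\langle a_0\vee a_1,b\rangle$ (for $a,a_0,a_1\in A^-$ and $b,b_0,b_1\in B^-$). A lattice $A$ with zero is called amenable if $A\otimes B$ is a lattice for every lattice $B$ with zero. A lattice is locally finite if each of its finite subsets generates a finite sublattice. $\mathrm{F}(3)$ denotes the free lattice on three generators (its zero is the meet of the generators). For a finite lattice $L$, let $\mathrm{J}(L)$ be the set of its join-irreducible elements ($0$ excluded). For $X,Y\subseteq L$ write $X\ll Y$ if every $x\in X$ lies below some $y\in Y$. A minimal pair of $L$ is a pair $\langle p,I\rangle$ with $p\in\mathrm{J}(L)$, $I\subseteq\mathrm{J}(L)$, $|I|\ge 2$, $p\notin I$, $p\le\bigvee I$, such that for all $J\subseteq\mathrm{J}(L)$, if $J\ll I$ and $p\le\bigvee J$, then $I\subseteq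 J$. The lattice $L$ satisfies $(\mathrm{T}_\vee)$ if $\mathrm{J}(L)$ has a linear ordering $\trianglelefteq$ such that $p\trianglelefteq j$ for every minimal pair $\langle p,I\rangle$ of $L$ and every $j\in I$. Theorem. For a lattice $A$ with zero, the following conditions are equivalent: (i) $A$ is amenable. (ii) $A$ is locally finite and $A\otimes B$ is a lattice, for every lattice $B$ with zero. (iii) $A$ is locally finite and $A\otimes\mathrm{F}(3)$ is a lattice. (iv) $A$ is locally finite and every finite sublattice of $A$ satisfies $(\mathrm{T}_\vee)$. -/

import Mathlib

universe u v

/-! ### The tensor product of two join-semilattices with zero -/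

section Tensor

variable (A : Type u) (B : Type v) [SemilatticeSup A] [OrderBot A] [SemilatticeSup B] [OrderBot B]

/-- Terms in the language of join-semilattices with zero (`∨`, `0`) over the generating set
`A⁻ × B⁻`, where `A⁻ = A \ {0}` and `B⁻ = B \ {0}`. -/
inductive TensorTerm : Type (max u v)
  | zero : TensorTerm
  | pure (a : {a : A // a ≠ ⊥}) (b : {b : B // b ≠ ⊥}) : TensorTerm
  | join (s t : TensorTerm) : TensorTerm

variable {A B}

/-- The join of two nonzero elements, as a nonzero element. -/
def nonzeroSup (x y : {a : A // a ≠ ⊥}) : {a : A // a ≠ ⊥} :=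
  ⟨x.1 ⊔ y.1, fun h => x.2 (sup_eq_bot_iff.mp h).1⟩

/-- The least preorder on terms for which `join` is a join, `zero` is a least element, and the
two defining families of relations
`⟨a, b₀⟩ ∨ ⟨a, b₁⟩ = ⟨a, b₀ ∨ b₁⟩` and `⟨a₀, b⟩ ∨ ⟨a₁, b⟩ = ⟨a₀ ∨ a₁, b⟩` hold
(each equality is written as two inequalities). -/
inductive TensorTerm.Le : TensorTerm A B → TensorTerm A B → Prop
  | refl (s) : Le s s
  | trans {s t r} : Le s t → Le t r → Le s r
  | zero_le (s) : Le zero s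
  | le_join_left (s t) : Le s (join s t)
  | le_join_right (s t) : Le t (join s t)
  | join_le {s t r} : Le s r → Le t r → Le (join s t) r
  | right_le (a b₀ b₁) : Le (join (pure a b₀) (pure a b₁)) (pure a (nonzeroSup b₀ b₁))
  | right_ge (a b₀ b₁) : Le (pure a (nonzeroSup b₀ b₁)) (join (pure a b₀) (pure a b₁))
  | left_le (a₀ a₁ b) : Le (join (pure a₀ b) (pure a₁ b)) (pure (nonzeroSup a₀ a₁) b)
  | left_ge (a₀ a₁ b) : Le (pure (nonzeroSup a₀ a₁) b) (join (pure a₀ b) (pure a₁ b))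

instance TensorTerm.instPreorder : Preorder (TensorTerm A B) where
  le := TensorTerm.Le
  le_refl := TensorTerm.Le.refl
  le_trans _ _ _ := TensorTerm.Le.trans

variable (A B)

/-- The tensor product `A ⊗ B` of two join-semilattices with zero: the free join-semilattice with
zero generated by the set `A⁻ × B⁻`, subject to the relations
`⟨a, b₀⟩ ∨ ⟨a, b₁⟩ = ⟨a, b₀ ∨ b₁⟩` and `⟨a₀, b⟩ ∨ ⟨a₁, b⟩ = ⟨a₀ ∨ a₁, b⟩`. -/
abbrev SemilatticeTensor : Type (max u v) :=
  Antisymmetrization (TensorTerm A B) (· ≤ ·)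

instance SemilatticeTensor.instSemilatticeSup : SemilatticeSup (SemilatticeTensor A B) where
  sup := Quotient.map₂ TensorTerm.join fun _ _ h _ _ k =>
    ⟨TensorTerm.Le.join_le (h.1.trans (TensorTerm.Le.le_join_left _ _))
        (k.1.trans (TensorTerm.Le.le_join_right _ _)),
      TensorTerm.Le.join_le (h.2.trans (TensorTerm.Le.le_join_left _ _))
        (k.2.trans (TensorTerm.Le.le_join_right _ _))⟩
  le_sup_left := by
    rintro ⟨s⟩ ⟨t⟩
    exact TensorTerm.Le.le_join_left s t
  le_sup_right := by
    rintro ⟨s⟩ ⟨t⟩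
    exact TensorTerm.Le.le_join_right s t
  sup_le := by
    rintro ⟨s⟩ ⟨t⟩ ⟨r⟩ h k
    exact TensorTerm.Le.join_le h k

instance SemilatticeTensor.instOrderBot : OrderBot (SemilatticeTensor A B) where
  bot := toAntisymmetrization (· ≤ ·) TensorTerm.zero
  bot_le := by
    rintro ⟨s⟩
    exact TensorTerm.Le.zero_le s

end Tensor

/-- A partially ordered set is a lattice if any two of its elements have a least upper bound and
a greatest lower bound. -/
def IsLatticeOrder (P : Type u) [PartialOrder P] : Prop :=
  ∀ x y : P, (∃ z, IsLUB {x, y} z) ∧ ∃ z, IsGLB {x, y} z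

/-! ### Free lattices -/

/-- Lattice terms over a set `X` of variables. -/
inductive LatticeTerm (X : Type u) : Type u
  | var (x : X) : LatticeTerm X
  | join (s t : LatticeTerm X) : LatticeTerm X
  | meet (s t : LatticeTerm X) : LatticeTerm X

/-- The least preorder on lattice terms for which `join` is a join and `meet` is a meet. -/
inductive LatticeTerm.Le {X : Type u} : LatticeTerm X → LatticeTerm X → Prop
  | refl (s) : Le s s
  | trans {s t r} : Le s t → Le t r → Le s r
  | le_join_left (s t) : Le s (join s t)
  | le_join_right (s t) : Le t (join s t)
  | join_le {s t r} : Le s r → Le t r → Le (join s t) r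
  | meet_le_left (s t) : Le (meet s t) s
  | meet_le_right (s t) : Le (meet s t) t
  | le_meet {s t r} : Le r s → Le r t → Le r (meet s t)

instance LatticeTerm.instPreorder {X : Type u} : Preorder (LatticeTerm X) where
  le := LatticeTerm.Le
  le_refl := LatticeTerm.Le.refl
  le_trans _ _ _ := LatticeTerm.Le.trans

/-- The free lattice on a set `X`. -/
abbrev FreeLatticeOn (X : Type u) : Type u :=
  Antisymmetrization (LatticeTerm X) (· ≤ ·)

instance FreeLatticeOn.instLattice (X : Type u) : Lattice (FreeLatticeOn X) where
  sup := Quotient.map₂ LatticeTerm.join fun _ _ h _ _ k =>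
    ⟨LatticeTerm.Le.join_le (h.1.trans (LatticeTerm.Le.le_join_left _ _))
        (k.1.trans (LatticeTerm.Le.le_join_right _ _)),
      LatticeTerm.Le.join_le (h.2.trans (LatticeTerm.Le.le_join_left _ _))
        (k.2.trans (LatticeTerm.Le.le_join_right _ _))⟩
  inf := Quotient.map₂ LatticeTerm.meet fun _ _ h _ _ k =>
    ⟨LatticeTerm.Le.le_meet ((LatticeTerm.Le.meet_le_left _ _).trans h.1)
        ((LatticeTerm.Le.meet_le_right _ _).trans k.1),
      LatticeTerm.Le.le_meet ((LatticeTerm.Le.meet_le_left _ _).trans h.2)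
        ((LatticeTerm.Le.meet_le_right _ _).trans k.2)⟩
  le_sup_left := by
    rintro ⟨s⟩ ⟨t⟩
    exact LatticeTerm.Le.le_join_left s t
  le_sup_right := by
    rintro ⟨s⟩ ⟨t⟩
    exact LatticeTerm.Le.le_join_right s t
  sup_le := by
    rintro ⟨s⟩ ⟨t⟩ ⟨r⟩ h k
    exact LatticeTerm.Le.join_le h k
  inf_le_left := by
    rintro ⟨s⟩ ⟨t⟩
    exact LatticeTerm.Le.meet_le_left s t
  inf_le_right := by
    rintro ⟨s⟩ ⟨t⟩
    exact LatticeTerm.Le.meet_le_right s t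
  le_inf := by
    rintro ⟨r⟩ ⟨s⟩ ⟨t⟩ h k
    exact LatticeTerm.Le.le_meet h k

/-- The free lattice `F(3)` on three generators. -/
abbrev F3 : Type := FreeLatticeOn (Fin 3)

/-- The zero of `F(3)` is the meet of the three free generators. -/
instance F3.instOrderBot : OrderBot F3 where
  bot := toAntisymmetrization (· ≤ ·)
    (.meet (.var 0) (.meet (.var 1) (.var 2)))
  bot_le := by
    rintro ⟨s⟩
    change LatticeTerm.Le _ s
    induction s with
    | var i =>
      fin_cases i
      · exact .meet_le_left _ _
      · exact .trans (.meet_le_right _ _) (.meet_le_left _ _)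
      · exact .trans (.meet_le_right _ _) (.meet_le_right _ _)
    | join s t hs _ => exact hs.trans (.le_join_left _ _)
    | meet s t hs ht => exact .le_meet hs ht

/-! ### Amenability, local finiteness, condition (T) -/

/-- A lattice `A` with zero is amenable if `A ⊗ B` is a lattice, for every lattice `B` with
zero. -/
def IsAmenableLattice (A : Type u) [Lattice A] [OrderBot A] : Prop :=
  ∀ (B : Type v) [Lattice B] [OrderBot B], IsLatticeOrder (SemilatticeTensor A B)

/-- A lattice is locally finite if every finite subset generates a finite sublattice. -/
def IsLocallyFiniteLattice (A : Type u) [Lattice A] : Prop :=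
  ∀ s : Set A, s.Finite → (latticeClosure s).Finite

/-- `X ≪ Y`: the set `X` is dominated by `Y`. -/
def IsDominatedBy {P : Type u} [Preorder P] (X Y : Set P) : Prop :=
  ∀ x ∈ X, ∃ y ∈ Y, x ≤ y

/-- `p ≤ ⋁ I`: the join of `I` exists and is above `p`. (In a finite lattice all joins exist, so
there this only says that `p` is below the join of `I`.) -/
def LeJoin {S : Type u} [SemilatticeSup S] (p : S) (I : Set S) : Prop :=
  ∃ s, IsLUB I s ∧ p ≤ s

/-- `⟨p, I⟩` is a minimal pair of the (finite) join-semilattice `S`; `SupIrred a` says that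
`a ∈ J(S)`. -/
structure IsMinimalPair {S : Type u} [SemilatticeSup S] (p : S) (I : Set S) : Prop where
  supIrred : SupIrred p
  subset_supIrred : ∀ i ∈ I, SupIrred i
  two_le_card : I.Nontrivial
  notMem : p ∉ I
  le_join : LeJoin p I
  minimal : ∀ J : Set S, (∀ j ∈ J, SupIrred j) → IsDominatedBy J I → LeJoin p J → I ⊆ J

/-- Condition (T) for a (finite) join-semilattice `S`: the set `J(S)` has a linear order `⊴` such
that `p ⊴ j` for every minimal pair `⟨p, I⟩` and every `j ∈ I`. -/
def SatisfiesT (S : Type u) [SemilatticeSup S] : Prop :=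
  ∃ o : LinearOrder {a : S // SupIrred a},
    ∀ (p j : {a : S // SupIrred a}) (I : Set S), IsMinimalPair p.1 I → j.1 ∈ I → o.le p j

/-- Condition (T_∨) for a (finite) lattice `L`: the join-semilattice `⟨L; ∨⟩` satisfies (T). -/
def SatisfiesTJoin (L : Type u) [Lattice L] : Prop :=
  SatisfiesT L

universe w

/-! For nonzero `x` and `y`, the tensor `x ⊗ y` lies below a finite join of pure tensors exactly
when every bi-ideal containing the generating pairs contains `(x, y)`. Upper bounds in the tensor
product are thus tested on well-chosen bi-ideals, and being a lattice means that the pairs below two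
given terms are the pairs below a third.

For a homomorphism `e : F(X) → A` and a homomorphism `g` from `F(X)` to the dual of `B`, the pairs
below `⋁ e(x) ⊗ g(x)` are those lying under some `(e p, g p)` (`exists_term_fraser`). Both necessity
proofs intersect such a join with one pure tensor and use that the meet has finitely many
generators.

Amenability forces local finiteness: in the lattice of double filters over `F(n)`, a suitable
intersection records the value of every polynomial `e z`, and finitely many generators leave only
finitely many values.

If `A ⊗ F(3)` is a lattice, any finite sublattice `S` is a lower bounded image of a free lattice.
For this `F(n)`, with `n = |S|`, is embedded in the dual of `F(3)`, and the meets yield a least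
preimage above each element of `S` (`exists_least_of_isLatticeOrder_tensor`). Term size of the least
preimages then drops along minimal pairs, which is `(T_∨)`.

Conversely, `(T_∨)` supplies a rank for a recursion that computes, for a term over `S`, an antitone
`F : S → B` whose pairs `(s, F s)` dominate everything below the term
(`exists_sections_of_satisfiesTJoin`). Pointwise meets of two such functions give the meet in `A ⊗
B`. -/

open Classical in
/-- The pure tensor `a ⊗ b`, as a term; it is zero as soon as `a` or `b` is. -/
noncomputable def tens {A : Type u} {B : Type v} [SemilatticeSup A] [OrderBot A]
    [SemilatticeSup B] [OrderBot B] (a : A) (b : B) : TensorTerm A B :=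
  if h : a ≠ ⊥ ∧ b ≠ ⊥ then .pure ⟨a, h.1⟩ ⟨b, h.2⟩ else .zero

/-- Hereditary sets of pairs that are closed under lateral joins. -/
structure IsBiIdeal {A : Type u} {B : Type v} [SemilatticeSup A] [SemilatticeSup B]
    (I : A → B → Prop) : Prop where
  lower : ∀ {a a' b b'}, a ≤ a' → b ≤ b' → I a' b' → I a b
  sup_left : ∀ {a a' b}, I a b → I a' b → I (a ⊔ a') b
  sup_right : ∀ {a b b'}, I a b → I a b' → I a (b ⊔ b')

/-! ### The order of the tensor product, through bi-ideals -/

section Terms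

variable {A : Type u} {B : Type v} [SemilatticeSup A] [OrderBot A] [SemilatticeSup B] [OrderBot B]

open Classical in
/-- The pairs occurring in a term. -/
noncomputable def TensorTerm.gens : TensorTerm A B → Finset (A × B)
  | .zero => ∅
  | .pure a b => {(a.1, b.1)}
  | .join s t => s.gens ∪ t.gens

theorem TensorTerm.zero_le' (τ : TensorTerm A B) : TensorTerm.zero ≤ τ := Le.zero_le τ

theorem TensorTerm.join_le_iff {σ τ ρ : TensorTerm A B} :
    TensorTerm.join σ τ ≤ ρ ↔ σ ≤ ρ ∧ τ ≤ ρ :=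
  ⟨fun h => ⟨(Le.le_join_left _ _).trans h, (Le.le_join_right _ _).trans h⟩,
    fun h => Le.join_le h.1 h.2⟩

theorem tens_of_ne {a : A} {b : B} (ha : a ≠ ⊥) (hb : b ≠ ⊥) :
    tens a b = .pure ⟨a, ha⟩ ⟨b, hb⟩ := dif_pos ⟨ha, hb⟩

theorem tens_le_of_left_eq_bot {a : A} {b : B} (h : a = ⊥) (τ : TensorTerm A B) :
    tens a b ≤ τ := by
  rw [tens, dif_neg (fun k => k.1 h)]
  exact τ.zero_le'

theorem tens_le_of_right_eq_bot {a : A} {b : B} (h : b = ⊥) (τ : TensorTerm A B) :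
    tens a b ≤ τ := by
  rw [tens, dif_neg (fun k => k.2 h)]
  exact τ.zero_le'

theorem tens_sup_left_le {a a' : A} {b : B} {τ : TensorTerm A B} (h : tens a b ≤ τ)
    (h' : tens a' b ≤ τ) : tens (a ⊔ a') b ≤ τ := by
  by_cases hb : b = ⊥
  · exact tens_le_of_right_eq_bot hb τ
  by_cases ha : a = ⊥
  · subst ha; simpa using h'
  by_cases ha' : a' = ⊥
  · subst ha'; simpa using h
  rw [tens_of_ne ha hb] at h
  rw [tens_of_ne ha' hb] at h'
  rw [tens_of_ne (fun k => ha (sup_eq_bot_iff.mp k).1) hb]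
  exact (TensorTerm.Le.left_ge ⟨a, ha⟩ ⟨a', ha'⟩ ⟨b, hb⟩).trans (.join_le h h')

theorem tens_sup_right_le {a : A} {b b' : B} {τ : TensorTerm A B} (h : tens a b ≤ τ)
    (h' : tens a b' ≤ τ) : tens a (b ⊔ b') ≤ τ := by
  by_cases ha : a = ⊥
  · exact tens_le_of_left_eq_bot ha τ
  by_cases hb : b = ⊥
  · subst hb; simpa using h'
  by_cases hb' : b' = ⊥
  · subst hb'; simpa using h
  rw [tens_of_ne ha hb] at h
  rw [tens_of_ne ha hb'] at h'
  rw [tens_of_ne ha (fun k => hb (sup_eq_bot_iff.mp k).1)]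
  exact (TensorTerm.Le.right_ge ⟨a, ha⟩ ⟨b, hb⟩ ⟨b', hb'⟩).trans (.join_le h h')

theorem tens_mono {a a' : A} {b b' : B} (ha : a ≤ a') (hb : b ≤ b') :
    tens a b ≤ tens a' b' := by
  by_cases h1 : a = ⊥
  · exact tens_le_of_left_eq_bot h1 _
  by_cases h2 : b = ⊥
  · exact tens_le_of_right_eq_bot h2 _
  have h1' : a' ≠ ⊥ := fun h => h1 (le_bot_iff.mp (h ▸ ha))
  have h2' : b' ≠ ⊥ := fun h => h2 (le_bot_iff.mp (h ▸ hb))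
  rw [tens_of_ne h1 h2, tens_of_ne h1' h2']
  have e1 : nonzeroSup ⟨a, h1⟩ ⟨a', h1'⟩ = ⟨a', h1'⟩ := Subtype.ext (sup_eq_right.mpr ha)
  have e2 : nonzeroSup ⟨b, h2⟩ ⟨b', h2'⟩ = ⟨b', h2'⟩ := Subtype.ext (sup_eq_right.mpr hb)
  have k1 := TensorTerm.Le.left_le ⟨a, h1⟩ ⟨a', h1'⟩ ⟨b, h2⟩
  have k2 := TensorTerm.Le.right_le ⟨a', h1'⟩ ⟨b, h2⟩ ⟨b', h2'⟩
  rw [e1] at k1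
  rw [e2] at k2
  exact ((TensorTerm.Le.le_join_left _ _).trans k1).trans
    ((TensorTerm.Le.le_join_left _ _).trans k2)

theorem TensorTerm.le_iff_gens {σ τ : TensorTerm A B} :
    σ ≤ τ ↔ ∀ g ∈ σ.gens, tens g.1 g.2 ≤ τ := by
  induction σ with
  | zero => simp [gens, zero_le']
  | pure a b => simp [gens, tens_of_ne a.2 b.2]
  | join s t hs ht =>
    rw [join_le_iff, hs, ht]
    simp only [gens, Finset.mem_union]
    exact ⟨fun h g hg => hg.elim (h.1 g) (h.2 g), fun h => ⟨fun g hg => h g (.inl hg),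
      fun g hg => h g (.inr hg)⟩⟩

theorem TensorTerm.tens_le_of_mem_gens {τ : TensorTerm A B} {g : A × B} (h : g ∈ τ.gens) :
    tens g.1 g.2 ≤ τ := le_iff_gens.mp le_rfl g h

theorem TensorTerm.ne_bot_of_mem_gens {τ : TensorTerm A B} {g : A × B} (h : g ∈ τ.gens) :
    g.1 ≠ ⊥ ∧ g.2 ≠ ⊥ := by
  induction τ with
  | zero => simp [gens] at h
  | pure a b =>
    simp only [gens, Finset.mem_singleton] at h
    subst h
    exact ⟨a.2, b.2⟩
  | join s t hs ht =>
    simp only [gens, Finset.mem_union] at h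
    exact h.elim hs ht

/-- Induction on the derivation of `σ ≤ τ`: each defining relation is matched by a closure property
of `I`. Generating pairs have nonzero coordinates, so `I` need not contain the pairs with a zero
coordinate. -/
theorem IsBiIdeal.gens_of_le {I : A → B → Prop} (hI : IsBiIdeal I) {σ τ : TensorTerm A B}
    (h : σ ≤ τ) (hτ : ∀ g ∈ τ.gens, I g.1 g.2) : ∀ g ∈ σ.gens, I g.1 g.2 := by
  change TensorTerm.Le σ τ at h
  induction h with
  | refl => exact hτ
  | trans _ _ h1 h2 => exact h1 (h2 hτ)
  | zero_le => simp [TensorTerm.gens]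
  | le_join_left => exact fun g hg => hτ g (by simp [TensorTerm.gens, hg])
  | le_join_right => exact fun g hg => hτ g (by simp [TensorTerm.gens, hg])
  | join_le _ _ h1 h2 =>
    intro g hg
    simp only [TensorTerm.gens, Finset.mem_union] at hg
    exact hg.elim (h1 hτ g) (h2 hτ g)
  | right_le a b₀ b₁ =>
    simp only [TensorTerm.gens, Finset.mem_singleton, Finset.mem_union, forall_eq_or_imp,
      forall_eq, nonzeroSup] at hτ ⊢
    exact ⟨hI.lower le_rfl le_sup_left hτ, hI.lower le_rfl le_sup_right hτ⟩
  | right_ge a b₀ b₁ =>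
    simp only [TensorTerm.gens, Finset.mem_singleton, Finset.mem_union, forall_eq_or_imp,
      forall_eq, nonzeroSup] at hτ ⊢
    exact hI.sup_right hτ.1 hτ.2
  | left_le a₀ a₁ b =>
    simp only [TensorTerm.gens, Finset.mem_singleton, Finset.mem_union, forall_eq_or_imp,
      forall_eq, nonzeroSup] at hτ ⊢
    exact ⟨hI.lower le_sup_left le_rfl hτ, hI.lower le_sup_right le_rfl hτ⟩
  | left_ge a₀ a₁ b =>
    simp only [TensorTerm.gens, Finset.mem_singleton, Finset.mem_union, forall_eq_or_imp,
      forall_eq, nonzeroSup] at hτ ⊢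
    exact hI.sup_left hτ.1 hτ.2

theorem IsBiIdeal.of_tens_le {I : A → B → Prop} (hI : IsBiIdeal I) {τ : TensorTerm A B}
    (hτ : ∀ g ∈ τ.gens, I g.1 g.2) {a : A} {b : B} (ha : a ≠ ⊥) (hb : b ≠ ⊥)
    (h : tens a b ≤ τ) : I a b := by
  have := hI.gens_of_le h hτ (a, b)
  rw [tens_of_ne ha hb] at this
  exact this (by simp [TensorTerm.gens])

theorem gens_tens_subset (a : A) (b : B) : (tens a b).gens ⊆ {(a, b)} := by
  unfold tens
  split_ifs <;> simp [TensorTerm.gens]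

theorem exists_term_of_finset (P : Finset (A × B)) :
    ∃ τ : TensorTerm A B, (∀ σ, τ ≤ σ ↔ ∀ g ∈ P, tens g.1 g.2 ≤ σ) ∧ τ.gens ⊆ P := by
  classical
  induction P using Finset.induction_on with
  | empty => exact ⟨.zero, fun σ => by simp [σ.zero_le'], by simp [TensorTerm.gens]⟩
  | insert g P _ ih =>
    obtain ⟨τ, hτ, h⟩ := ih
    refine ⟨.join (tens g.1 g.2) τ, fun σ => by simp [TensorTerm.join_le_iff, hτ], ?_⟩
    intro x hx
    rw [TensorTerm.gens, Finset.mem_union] at hx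
    rcases hx with hx | hx
    · exact Finset.mem_insert.mpr (.inl (Finset.mem_singleton.mp (gens_tens_subset _ _ hx)))
    · exact Finset.mem_insert_of_mem (h hx)

/-- Joins are always present, and each term is a join of pure tensors, so a meet is determined by
the pure tensors below it. -/
theorem isLatticeOrder_tensor_iff :
    IsLatticeOrder (SemilatticeTensor A B) ↔ ∀ σ τ : TensorTerm A B,
      ∃ ρ : TensorTerm A B, ∀ a b, tens a b ≤ ρ ↔ tens a b ≤ σ ∧ tens a b ≤ τ := by
  constructor
  · intro h σ τ
    obtain ⟨z, hz⟩ := (h (toAntisymmetrization (· ≤ ·) σ) (toAntisymmetrization (· ≤ ·) τ)).2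
    induction z using Quotient.inductionOn with | _ ρ
    refine ⟨ρ, fun a b => ⟨fun h => ?_, fun h => ?_⟩⟩
    · exact ⟨h.trans (hz.1 (Set.mem_insert _ _)), h.trans (hz.1 (Set.mem_insert_of_mem _ rfl))⟩
    · have hl : toAntisymmetrization (· ≤ ·) (tens a b) ∈ lowerBounds
          {toAntisymmetrization (· ≤ ·) σ, toAntisymmetrization (· ≤ ·) τ} := ?_
      · exact hz.2 hl
      rintro y (rfl | rfl)
      · exact h.1
      · exact h.2
  · rintro h ⟨σ⟩ ⟨τ⟩
    refine ⟨⟨_, isLUB_pair⟩, ?_⟩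
    obtain ⟨ρ, hρ⟩ := h σ τ
    refine ⟨toAntisymmetrization (· ≤ ·) ρ, ?_, ?_⟩
    · rintro y (rfl | rfl)
      · exact TensorTerm.le_iff_gens.mpr fun g hg =>
          ((hρ _ _).mp (TensorTerm.tens_le_of_mem_gens hg)).1
      · exact TensorTerm.le_iff_gens.mpr fun g hg =>
          ((hρ _ _).mp (TensorTerm.tens_le_of_mem_gens hg)).2
    · rintro ⟨π⟩ hπ
      have h1 : π ≤ σ := hπ (Set.mem_insert _ _)
      have h2 : π ≤ τ := hπ (Set.mem_insert_of_mem _ rfl)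
      exact TensorTerm.le_iff_gens.mpr fun g hg => (hρ _ _).mpr
        ⟨(TensorTerm.tens_le_of_mem_gens hg).trans h1, (TensorTerm.tens_le_of_mem_gens hg).trans h2⟩

end Terms

/-! ### Replacing the second factor by an isomorphic one, possibly in another universe -/

section Transfer

variable {A : Type u} {B : Type v} {B' : Type*} [SemilatticeSup A] [OrderBot A]
  [SemilatticeSup B] [OrderBot B] [SemilatticeSup B'] [OrderBot B']

theorem exists_term_transfer (f : B ≃o B') (τ : TensorTerm A B) :
    ∃ τ' : TensorTerm A B', ∀ a b, tens a (f b) ≤ τ' ↔ tens a b ≤ τ := by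
  classical
  obtain ⟨τ', hτ', hg⟩ := exists_term_of_finset (τ.gens.image fun g => (g.1, f g.2))
  have hτ'' := (hτ' τ').mp le_rfl
  refine ⟨τ', fun a b => ?_⟩
  by_cases ha : a = ⊥
  · simp only [tens_le_of_left_eq_bot ha]
  by_cases hb : b = ⊥
  · simp only [tens_le_of_right_eq_bot, hb, map_bot]
  refine ⟨fun h => ?_, fun h => ?_⟩
  · have hI : IsBiIdeal fun (a : A) (b : B') => tens a (f.symm b) ≤ τ :=
      ⟨fun ha hb h => (tens_mono ha (f.symm.monotone hb)).trans h, tens_sup_left_le,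
        fun h h' => by rw [map_sup]; exact tens_sup_right_le h h'⟩
    have key : ∀ g ∈ τ'.gens, tens g.1 (f.symm g.2) ≤ τ := by
      intro g hg'
      obtain ⟨g', h', rfl⟩ := Finset.mem_image.mp (hg hg')
      simpa using TensorTerm.tens_le_of_mem_gens h'
    have := hI.of_tens_le key ha (fun k => hb ((map_eq_bot_iff f).mp k)) h
    simpa using this
  · have hI : IsBiIdeal fun (a : A) (b : B) => tens a (f b) ≤ τ' :=
      ⟨fun ha hb h => (tens_mono ha (f.monotone hb)).trans h, tens_sup_left_le,
        fun h h' => by rw [map_sup]; exact tens_sup_right_le h h'⟩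
    exact hI.of_tens_le (fun g hg => hτ'' _ (Finset.mem_image_of_mem _ hg)) ha hb h

theorem isLatticeOrder_tensor_of_orderIso (f : B ≃o B')
    (h : IsLatticeOrder (SemilatticeTensor A B)) : IsLatticeOrder (SemilatticeTensor A B') := by
  rw [isLatticeOrder_tensor_iff] at h ⊢
  intro σ τ
  obtain ⟨σ', hσ⟩ := exists_term_transfer f.symm σ
  obtain ⟨τ', hτ⟩ := exists_term_transfer f.symm τ
  obtain ⟨ρ, hρ⟩ := h σ' τ'
  obtain ⟨ρ', hρ'⟩ := exists_term_transfer f ρ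
  refine ⟨ρ', fun a b => ?_⟩
  rw [← hσ, ← hτ, ← hρ, ← hρ', f.apply_symm_apply]

end Transfer

/-! ### Whitman's condition and its versions for finite joins and meets -/

/-- Whitman's condition (W). -/
def Whitman (M : Type u) [Lattice M] : Prop :=
  ∀ a b c d : M, a ⊓ b ≤ c ⊔ d → a ≤ c ⊔ d ∨ b ≤ c ⊔ d ∨ a ⊓ b ≤ c ∨ a ⊓ b ≤ d

section Whitman

variable {M : Type u} [Lattice M]

theorem Whitman.dual (h : Whitman M) : Whitman Mᵒᵈ := by
  intro a b c d k
  rcases h (OrderDual.ofDual c) (OrderDual.ofDual d) (OrderDual.ofDual a) (OrderDual.ofDual b) k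
    with k | k | k | k
  · exact .inr (.inr (.inl k))
  · exact .inr (.inr (.inr k))
  · exact .inl k
  · exact .inr (.inl k)

theorem Whitman.inf_le_sup' (h : Whitman M) {ι : Type*} {U : Finset ι} (hU : U.Nonempty)
    (f : ι → M) {a b : M} (k : a ⊓ b ≤ U.sup' hU f) :
    a ≤ U.sup' hU f ∨ b ≤ U.sup' hU f ∨ ∃ i ∈ U, a ⊓ b ≤ f i := by
  classical
  induction hU using Finset.Nonempty.cons_induction with
  | singleton i => exact .inr (.inr ⟨i, by simpa using k⟩)
  | cons i U hi hU ih =>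
    rw [Finset.sup'_cons hU] at k ⊢
    rcases h _ _ _ _ k with k | k | k | k
    · exact .inl k
    · exact .inr (.inl k)
    · exact .inr (.inr ⟨i, by simp, k⟩)
    · rcases ih k with k | k | ⟨j, hj, k⟩
      · exact .inl (k.trans le_sup_right)
      · exact .inr (.inl (k.trans le_sup_right))
      · exact .inr (.inr ⟨j, by simp [hj], k⟩)

theorem Whitman.inf'_le_sup (h : Whitman M) {ι : Type*} {U : Finset ι} (hU : U.Nonempty)
    (f : ι → M) {a b : M} (k : U.inf' hU f ≤ a ⊔ b) :
    U.inf' hU f ≤ a ∨ U.inf' hU f ≤ b ∨ ∃ i ∈ U, f i ≤ a ⊔ b :=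
  h.dual.inf_le_sup' hU (fun i => OrderDual.toDual (f i)) k

end Whitman

/-! ### The word problem for free lattices -/

namespace LatticeTerm

variable {X : Type v} {M : Type u} [Lattice M]

/-- The value of a lattice term. -/
def eval (w : X → M) : LatticeTerm X → M
  | var x => w x
  | join s t => s.eval w ⊔ t.eval w
  | meet s t => s.eval w ⊓ t.eval w

theorem eval_mono (w : X → M) {s t : LatticeTerm X} (h : s ≤ t) : s.eval w ≤ t.eval w := by
  change Le s t at h
  induction h with
  | refl => exact le_rfl
  | trans _ _ h1 h2 => exact h1.trans h2
  | le_join_left => exact le_sup_left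
  | le_join_right => exact le_sup_right
  | join_le _ _ h1 h2 => exact sup_le h1 h2
  | meet_le_left => exact inf_le_left
  | meet_le_right => exact inf_le_right
  | le_meet _ _ h1 h2 => exact le_inf h1 h2

theorem join_le_iff {s t r : LatticeTerm X} : join s t ≤ r ↔ s ≤ r ∧ t ≤ r :=
  ⟨fun h => ⟨(Le.le_join_left _ _).trans h, (Le.le_join_right _ _).trans h⟩,
    fun h => Le.join_le h.1 h.2⟩

theorem le_meet_iff {s t r : LatticeTerm X} : r ≤ meet s t ↔ r ≤ s ∧ r ≤ t :=
  ⟨fun h => ⟨Le.trans h (.meet_le_left _ _), Le.trans h (.meet_le_right _ _)⟩,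
    fun h => Le.le_meet h.1 h.2⟩

/-- The upper copy in the lattice obtained by doubling the interval `[p, q]`. -/
def Upper (p q : LatticeTerm X) : LatticeTerm X → Prop
  | var x => p ≤ var x ∧ ¬ var x ≤ q
  | join s t => Upper p q s ∨ Upper p q t ∨ (p ≤ join s t ∧ ¬ join s t ≤ q)
  | meet s t => Upper p q s ∧ Upper p q t

theorem Upper.le {p q s : LatticeTerm X} (h : Upper p q s) : p ≤ s := by
  induction s with
  | var x => exact h.1
  | join s t hs ht =>
    rcases h with h | h | h
    · exact (hs h).trans (Le.le_join_left _ _)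
    · exact (ht h).trans (Le.le_join_right _ _)
    · exact h.1
  | meet s t hs ht => exact Le.le_meet (hs h.1) (ht h.2)

theorem upper_of_le_of_not_le {p q s : LatticeTerm X} (h : p ≤ s) (h' : ¬ s ≤ q) :
    Upper p q s := by
  induction s with
  | var x => exact ⟨h, h'⟩
  | join s t => exact .inr (.inr ⟨h, h'⟩)
  | meet s t hs ht =>
    rw [le_meet_iff] at h
    exact ⟨hs h.1 fun k => h' (Le.trans (.meet_le_left _ _) k),
      ht h.2 fun k => h' (Le.trans (.meet_le_right _ _) k)⟩

/-- With `[p, q]` doubled and variables inside it sent to the lower copy, `Upper p q s` says that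
the value of `s` is above the upper copy of `p`. Evaluation is monotone. -/
theorem Upper.mono {p q s t : LatticeTerm X} (h : s ≤ t) (hs : Upper p q s) : Upper p q t := by
  change Le s t at h
  induction h with
  | refl => exact hs
  | trans _ _ h1 h2 => exact h2 (h1 hs)
  | le_join_left => exact .inl hs
  | le_join_right => exact .inr (.inl hs)
  | join_le h1 h2 ih1 ih2 =>
    rcases hs with hs | hs | hs
    · exact ih1 hs
    · exact ih2 hs
    · exact upper_of_le_of_not_le (hs.1.trans (join_le_iff.mpr ⟨h1, h2⟩))
        fun k => hs.2 ((join_le_iff.mpr ⟨h1, h2⟩).trans k)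
  | meet_le_left => exact hs.1
  | meet_le_right => exact hs.2
  | le_meet _ _ ih1 ih2 => exact ⟨ih1 hs, ih2 hs⟩

/-- Day's doubling: if (W) fails, double the interval from `a ∧ b` to `c ∨ d`. Then `a` and `b`,
hence their meet, evaluate into the upper part, while `c ∨ d` does not. -/
theorem whitman {a b c d : LatticeTerm X} (h : meet a b ≤ join c d) :
    a ≤ join c d ∨ b ≤ join c d ∨ meet a b ≤ c ∨ meet a b ≤ d := by
  by_contra! hn
  have h1 : Upper (meet a b) (join c d) (meet a b) :=
    ⟨upper_of_le_of_not_le (Le.meet_le_left _ _) hn.1,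
      upper_of_le_of_not_le (Le.meet_le_right _ _) hn.2.1⟩
  rcases h1.mono h with k | k | k
  · exact hn.2.2.1 k.le
  · exact hn.2.2.2 k.le
  · exact k.2 le_rfl

/-- Evaluation reflects the order as soon as the values of the variables are independent elements
of a lattice with Whitman's condition. -/
theorem le_of_eval_le (hM : Whitman M) {w : X → M}
    (hj : ∀ i, ∃ y, ¬ w i ≤ y ∧ ∀ j, j ≠ i → w j ≤ y)
    (hm : ∀ i, ∃ y, ¬ y ≤ w i ∧ ∀ j, j ≠ i → y ≤ w j) {p q : LatticeTerm X}
    (h : p.eval w ≤ q.eval w) : p ≤ q := by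
  have H1 : ∀ (i : X) (q : LatticeTerm X), w i ≤ q.eval w → var i ≤ q := by
    intro i q hq
    obtain ⟨y, hy, hy'⟩ := hj i
    -- This dichotomy survives joins and meets, so independence makes the variable join-prime with
    -- respect to values; `H2` is the dual argument.
    have : ∀ q : LatticeTerm X, var i ≤ q ∨ q.eval w ≤ y := by
      intro q
      induction q with
      | var j =>
        by_cases hji : j = i
        · exact .inl (hji ▸ le_rfl)
        · exact .inr (hy' j hji)
      | join s t hs ht =>
        rcases hs with hs | hs
        · exact .inl (hs.trans (Le.le_join_left _ _))
        rcases ht with ht | ht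
        · exact .inl (ht.trans (Le.le_join_right _ _))
        exact .inr (sup_le hs ht)
      | meet s t hs ht =>
        rcases hs with hs | hs
        · exact ht.imp (fun ht => le_meet_iff.mpr ⟨hs, ht⟩) (inf_le_right.trans ·)
        · exact .inr (inf_le_left.trans hs)
    exact (this q).resolve_right fun k => hy (hq.trans k)
  have H2 : ∀ (i : X) (q : LatticeTerm X), q.eval w ≤ w i → q ≤ var i := by
    intro i q hq
    obtain ⟨y, hy, hy'⟩ := hm i
    have : ∀ q : LatticeTerm X, q ≤ var i ∨ y ≤ q.eval w := by
      intro q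
      induction q with
      | var j =>
        by_cases hji : j = i
        · exact .inl (hji ▸ le_rfl)
        · exact .inr (hy' j hji)
      | meet s t hs ht =>
        rcases hs with hs | hs
        · exact .inl (Le.trans (.meet_le_left _ _) hs)
        rcases ht with ht | ht
        · exact .inl (Le.trans (.meet_le_right _ _) ht)
        exact .inr (le_inf hs ht)
      | join s t hs ht =>
        rcases hs with hs | hs
        · exact ht.imp (fun ht => join_le_iff.mpr ⟨hs, ht⟩) (·.trans le_sup_right)
        · exact .inr (hs.trans le_sup_left)
    exact (this q).resolve_right fun k => hy (k.trans hq)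
  induction p generalizing q with
  | var i => exact H1 i q h
  | join s t hs ht => exact join_le_iff.mpr ⟨hs (le_sup_left.trans h), ht (le_sup_right.trans h)⟩
  | meet s t hs ht =>
    induction q with
    | var i => exact H2 i _ h
    | meet a b ha hb =>
      exact le_meet_iff.mpr ⟨ha (h.trans inf_le_left), hb (h.trans inf_le_right)⟩
    | join a b ha hb =>
      rcases hM _ _ _ _ h with k | k | k | k
      · exact Le.trans (.meet_le_left _ _) (hs (q := join a b) k)
      · exact Le.trans (.meet_le_right _ _) (ht (q := join a b) k)
      · exact (ha k).trans (Le.le_join_left _ _)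
      · exact (hb k).trans (Le.le_join_right _ _)

/-- The number of symbols of a term. -/
def size : LatticeTerm X → ℕ
  | var _ => 1
  | join s t => s.size + t.size + 1
  | meet s t => s.size + t.size + 1

end LatticeTerm

/-! ### Free lattices: universal property and refinement of join covers -/

namespace FreeLatticeOn

variable {X : Type v} {M : Type u} [Lattice M]

/-- The class of a term in the free lattice. -/
def mk (t : LatticeTerm X) : FreeLatticeOn X := toAntisymmetrization (· ≤ ·) t

theorem mk_join (s t : LatticeTerm X) : mk (s.join t) = mk s ⊔ mk t := rfl

theorem mk_meet (s t : LatticeTerm X) : mk (s.meet t) = mk s ⊓ mk t := rfl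

theorem exists_mk_eq (p : FreeLatticeOn X) : ∃ t, mk t = p := Quotient.exists_rep p

theorem whitman : Whitman (FreeLatticeOn X) := by
  rintro ⟨a⟩ ⟨b⟩ ⟨c⟩ ⟨d⟩ h
  exact LatticeTerm.whitman h

/-- The homomorphism from the free lattice that extends a given map. -/
def lift (w : X → M) : LatticeHom (FreeLatticeOn X) M where
  toFun := Quotient.lift (LatticeTerm.eval w) fun _ _ h =>
    le_antisymm (LatticeTerm.eval_mono w h.1) (LatticeTerm.eval_mono w h.2)
  map_sup' := by rintro ⟨s⟩ ⟨t⟩; rfl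
  map_inf' := by rintro ⟨s⟩ ⟨t⟩; rfl

theorem lift_var (w : X → M) (x : X) : lift w (mk (.var x)) = w x := rfl

theorem induction {P : FreeLatticeOn X → Prop} (var : ∀ x, P (mk (.var x)))
    (sup : ∀ p q, P p → P q → P (p ⊔ q)) (inf : ∀ p q, P p → P q → P (p ⊓ q))
    (p : FreeLatticeOn X) : P p := by
  obtain ⟨t, rfl⟩ := exists_mk_eq p
  induction t with
  | var x => exact var x
  | join s t hs ht => exact sup _ _ hs ht
  | meet s t hs ht => exact inf _ _ hs ht

theorem le_of_lift_le (hM : Whitman M) {w : X → M}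
    (hj : ∀ i, ∃ y, ¬ w i ≤ y ∧ ∀ j, j ≠ i → w j ≤ y)
    (hm : ∀ i, ∃ y, ¬ y ≤ w i ∧ ∀ j, j ≠ i → y ≤ w j) {p q : FreeLatticeOn X}
    (h : lift w p ≤ lift w q) : p ≤ q := by
  obtain ⟨s, rfl⟩ := exists_mk_eq p
  obtain ⟨t, rfl⟩ := exists_mk_eq q
  exact LatticeTerm.le_of_eval_le hM hj hm h

/-- Variables are join-prime. -/
theorem exists_var_le_of_le_sup' {ι : Type*} {U : Finset ι} (hU : U.Nonempty)
    (f : ι → FreeLatticeOn X) {x : X} (h : mk (.var x) ≤ U.sup' hU f) :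
    ∃ i ∈ U, mk (.var x) ≤ f i := by
  -- The homomorphism to truth values that makes only `x` true detects the filter above `x`, which
  -- is therefore prime.
  have key : ∀ p : FreeLatticeOn X, lift (fun y => y = x) p ↔ mk (.var x) ≤ p := by
    have h1 : ∀ p : FreeLatticeOn X, lift (fun y => y = x) p → mk (.var x) ≤ p := by
      intro p
      induction p using FreeLatticeOn.induction with
      | var y => rintro (rfl : y = x); exact le_rfl
      | sup p q hp hq =>
        rw [map_sup]
        rintro (k | k)
        · exact (hp k).trans le_sup_left
        · exact (hq k).trans le_sup_right
      | inf p q hp hq =>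
        rw [map_inf]
        exact fun k => le_inf (hp k.1) (hq k.2)
    exact fun p => ⟨h1 p, fun k => OrderHomClass.mono (lift fun y => y = x) k rfl⟩
  by_contra! hn
  refine Finset.sup'_induction hU f (p := fun a => ¬ mk (.var x) ≤ a) ?_ hn h
  intro a ha b hb k
  rw [← key, map_sup] at k
  exact k.elim (fun k => ha ((key a).mp k)) (fun k => hb ((key b).mp k))

/-- A join cover of the value of a term is refined by a join cover of values of smaller terms. -/
theorem exists_refinement {U : Finset (FreeLatticeOn X)} (hU : U.Nonempty) (t : LatticeTerm X)
    (h : mk t ≤ U.sup' hU id) : (∃ u ∈ U, mk t ≤ u) ∨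
      ∃ V : Finset (LatticeTerm X), ∃ hV : V.Nonempty, mk t ≤ V.sup' hV mk ∧
        ∀ v ∈ V, v.size < t.size ∧ ∃ u ∈ U, mk v ≤ u := by
  classical
  -- In the recursive calls a term that lies under a single member of `U` is its own cover; size
  -- then drops only weakly, and the enclosing `join` or `meet` symbol makes the drop strict.
  have H : ∀ (s : LatticeTerm X), ((∃ u ∈ U, mk s ≤ u) ∨
      ∃ V : Finset (LatticeTerm X), ∃ hV : V.Nonempty, mk s ≤ V.sup' hV mk ∧
        ∀ v ∈ V, v.size < s.size ∧ ∃ u ∈ U, mk v ≤ u) →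
      ∃ V : Finset (LatticeTerm X), ∃ hV : V.Nonempty, mk s ≤ V.sup' hV mk ∧
        ∀ v ∈ V, v.size ≤ s.size ∧ ∃ u ∈ U, mk v ≤ u := by
    rintro s (⟨u, hu, k⟩ | ⟨V, hV, k, k'⟩)
    · exact ⟨{s}, Finset.singleton_nonempty s, by simp, by simpa using ⟨u, hu, k⟩⟩
    · exact ⟨V, hV, k, fun v hv => ⟨(k' v hv).1.le, (k' v hv).2⟩⟩
  induction t with
  | var x => exact .inl (exists_var_le_of_le_sup' hU id h)
  | join s t hs ht =>
    rw [mk_join] at h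
    obtain ⟨V, hV, k, k'⟩ := H s (hs (le_sup_left.trans h))
    obtain ⟨V', hV', l, l'⟩ := H t (ht (le_sup_right.trans h))
    refine .inr ⟨V ∪ V', hV.mono Finset.subset_union_left, ?_, ?_⟩
    · rw [Finset.sup'_union hV hV', mk_join]
      exact sup_le_sup k l
    · intro v hv
      rcases Finset.mem_union.mp hv with hv | hv
      · exact ⟨by have := (k' v hv).1; simp only [LatticeTerm.size]; omega, (k' v hv).2⟩
      · exact ⟨by have := (l' v hv).1; simp only [LatticeTerm.size]; omega, (l' v hv).2⟩
  | meet s t hs ht =>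
    rw [mk_meet] at h
    rcases whitman.inf_le_sup' hU id h with k | k | k
    · obtain ⟨V, hV, k, k'⟩ := H s (hs k)
      refine .inr ⟨V, hV, ?_, fun v hv =>
        ⟨by have := (k' v hv).1; simp only [LatticeTerm.size]; omega, (k' v hv).2⟩⟩
      rw [mk_meet]
      exact inf_le_left.trans k
    · obtain ⟨V, hV, k, k'⟩ := H t (ht k)
      refine .inr ⟨V, hV, ?_, fun v hv =>
        ⟨by have := (k' v hv).1; simp only [LatticeTerm.size]; omega, (k' v hv).2⟩⟩
      rw [mk_meet]
      exact inf_le_right.trans k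
    · exact .inl k

end FreeLatticeOn

/-! ### Independent families in a lattice with Whitman's condition and a free triple -/

section Zigzag

variable {M : Type u} [Lattice M]

/-- Every assignment of truth values to `x`, `y`, `z` extends to a homomorphism. -/
def FreeTriple (x y z : M) : Prop :=
  ∀ P Q R : Prop, ∃ h : LatticeHom M Prop, (h x ↔ P) ∧ (h y ↔ Q) ∧ (h z ↔ R)

theorem FreeTriple.dual {x y z : M} (H : FreeTriple x y z) :
    FreeTriple (OrderDual.toDual x) (OrderDual.toDual y) (OrderDual.toDual z) := by
  intro P Q R
  obtain ⟨h, hx, hy, hz⟩ := H (¬ P) (¬ Q) (¬ R)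
  refine ⟨⟨⟨fun a => ¬ h (OrderDual.ofDual a), fun a b => ?_⟩, fun a b => ?_⟩, ?_, ?_, ?_⟩
  · simp [imp_iff_not_or]
  · simp
  · exact (not_congr hx).trans not_not
  · exact (not_congr hy).trans not_not
  · exact (not_congr hz).trans not_not

theorem FreeTriple.rotate {x y z : M} (H : FreeTriple x y z) : FreeTriple y z x := by
  intro P Q R
  obtain ⟨h, hx, hy, hz⟩ := H R P Q
  exact ⟨h, hy, hz, hx⟩

/-- An ascending sequence of lattice polynomials in three variables. -/
def zigzag (x y z : M) : ℕ → M
  | 0 => x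
  | k + 1 => x ⊔ (y ⊓ (z ⊔ (x ⊓ (y ⊔ (z ⊓ zigzag x y z k)))))

/-- An ascending sequence of lattice polynomials in three variables, below the first of them. -/
def zigzagBelow (x y z : M) (k : ℕ) : M := x ⊓ (y ⊔ (z ⊓ zigzag x y z k))

theorem zigzag_zero (x y z : M) : zigzag x y z 0 = x := rfl

theorem zigzag_succ (x y z : M) (k : ℕ) :
    zigzag x y z (k + 1) = x ⊔ (y ⊓ (z ⊔ zigzagBelow x y z k)) := rfl

theorem zigzag_mono (x y z : M) : Monotone (zigzag x y z) := by
  refine monotone_nat_of_le_succ fun k => ?_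
  induction k with
  | zero => exact le_sup_left
  | succ k ih =>
    rw [zigzag, zigzag]
    gcongr

theorem zigzagBelow_def (x y z : M) (k : ℕ) :
    zigzagBelow x y z k = x ⊓ (y ⊔ (z ⊓ zigzag x y z k)) := rfl

theorem zigzagBelow_mono (x y z : M) : Monotone (zigzagBelow x y z) := by
  intro i j hij
  have := zigzag_mono x y z hij
  unfold zigzagBelow
  gcongr

/-- Refutes inequalities by one truth assignment. The values on both zigzag sequences do not depend
on the index, except that `zigzag` at `0` is `x`. -/
theorem FreeTriple.not_le {x y z : M} (H : FreeTriple x y z) (P Q R : Prop) {a b : M}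
    (hab : ∀ h : LatticeHom M Prop, (h x ↔ P) → (h y ↔ Q) → (h z ↔ R) →
      (∀ k, h (zigzag x y z (k + 1)) ↔ P ∨ (Q ∧ R)) →
      (∀ k, h (zigzagBelow x y z k) ↔ P ∧ (Q ∨ R)) → h a ∧ ¬ h b) : ¬ a ≤ b := by
  intro hle
  obtain ⟨h, hx, hy, hz⟩ := H P Q R
  have hs : ∀ k, P → h (zigzag x y z k) := by
    intro k hP
    exact OrderHomClass.mono h (zigzag_mono x y z (Nat.zero_le k)) (hx.mpr hP)
  have hA : ∀ k, h (zigzagBelow x y z k) ↔ P ∧ (Q ∨ R) := by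
    intro k
    have := hs k
    simp only [zigzagBelow, map_inf, map_sup, sup_Prop_eq, inf_Prop_eq, hx, hy, hz]
    tauto
  have hs' : ∀ k, h (zigzag x y z (k + 1)) ↔ P ∨ (Q ∧ R) := by
    intro k
    simp only [zigzag_succ, map_inf, map_sup, sup_Prop_eq, inf_Prop_eq, hx, hy, hz, hA]
    tauto
  have := hab h hx hy hz hs' hA
  exact this.2 (OrderHomClass.mono h hle this.1)

-- A failure of strictness descends: (W) strips one layer of the polynomials at a time, truth
-- assignments refute all other branches, and what remains is `zigzag 1 ≤ x`, false when only `y`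
-- and `z` are true.
set_option linter.unusedSimpArgs false in
theorem zigzag_strict (hM : Whitman M) {x y z : M} (H : FreeTriple x y z) (k : ℕ) :
    ¬ zigzag x y z (k + 1) ≤ zigzag x y z k ∧
      ¬ zigzagBelow x y z (k + 1) ≤ zigzagBelow x y z k := by
  have step1 : ∀ k, zigzag x y z (k + 2) ≤ zigzag x y z (k + 1) →
      zigzagBelow x y z (k + 1) ≤ zigzagBelow x y z k := by
    intro k hk
    have h1 : y ⊓ (z ⊔ zigzagBelow x y z (k + 1)) ≤ x ⊔ (y ⊓ (z ⊔ zigzagBelow x y z k)) :=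
      le_sup_right.trans hk
    rcases hM _ _ _ _ h1 with h | h | h | h
    · exact (H.not_le False True False (fun h hx hy hz hs hA => by simp [hx, hy, hz, hs, hA]) h).elim
    · exact (H.not_le False False True (fun h hx hy hz hs hA => by simp [hx, hy, hz, hs, hA]) h).elim
    · exact (H.not_le False True True (fun h hx hy hz hs hA => by simp [hx, hy, hz, hs, hA]) h).elim
    · rcases hM _ _ _ _ (h.trans inf_le_right) with h | h | h | h
      · exact (H.not_le False True False (fun h hx hy hz hs hA => by simp [hx, hy, hz, hs, hA]) h).elim
      · rcases hM _ _ _ _ (show x ⊓ (y ⊔ (z ⊓ zigzag x y z (k + 1))) ≤ z ⊔ zigzagBelow x y z k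
          from le_sup_right.trans h) with h | h | h | h
        · exact (H.not_le True False False (fun h hx hy hz hs hA => by simp [hx, hy, hz, hs, hA]) h).elim
        · exact (H.not_le False True False (fun h hx hy hz hs hA => by simp [hx, hy, hz, hs, hA]) h).elim
        · exact (H.not_le True True False (fun h hx hy hz hs hA => by simp [hx, hy, hz, hs, hA]) h).elim
        · exact h
      · exact (H.not_le True True False (fun h hx hy hz hs hA => by simp [hx, hy, hz, hs, hA]) h).elim
      · exact (H.not_le False True True (fun h hx hy hz hs hA => by simp [hx, hy, hz, hs, hA]) h).elim
  have step2 : ∀ k, zigzagBelow x y z (k + 1) ≤ zigzagBelow x y z k →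
      zigzag x y z (k + 1) ≤ zigzag x y z k := by
    intro k hk
    rcases hM _ _ _ _ (show x ⊓ (y ⊔ (z ⊓ zigzag x y z (k + 1))) ≤ y ⊔ (z ⊓ zigzag x y z k)
      from hk.trans inf_le_right) with h | h | h | h
    · exact (H.not_le True False False (fun h hx hy hz hs hA => by simp [hx, hy, hz, hs, hA]) h).elim
    · rcases hM _ _ _ _ (le_sup_right.trans h) with h | h | h | h
      · exact (H.not_le False False True (fun h hx hy hz hs hA => by
        cases k <;> simp [hx, hy, hz, hs, zigzag_zero]) h).elim
      · exact (H.not_le True False False (fun h hx hy hz hs hA => by simp [hx, hy, hz, hs, hA]) h).elim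
      · exact (H.not_le True False True (fun h hx hy hz hs hA => by simp [hx, hy, hz, hs, hA]) h).elim
      · cases k with
        | zero => exact (H.not_le False True True (fun h hx hy hz hs hA => by
          simp [hx, hy, hz, hs, zigzag_zero]) h).elim
        | succ k =>
          rcases hM _ _ _ _ (h.trans inf_le_right) with h | h | h | h
          · exact (H.not_le False False True (fun h hx hy hz hs hA => by simp [hx, hy, hz]) h).elim
          · exact h
          · exact (H.not_le False True True (fun h hx hy hz hs hA => by simp [hx, hy, hz, hs, hA]) h).elim
          · exact (H.not_le True False True (fun h hx hy hz hs hA => by simp [hx, hy, hz, hs, hA]) (h.trans inf_le_left)).elim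
    · exact (H.not_le True False True (fun h hx hy hz hs hA =>
        ⟨(hA (k + 1)).mpr (by simp), by simp [hy]⟩) h).elim
    · exact (H.not_le True True False (fun h hx hy hz hs hA => by simp [hx, hy, hz, hs, hA]) (h.trans inf_le_left)).elim
  have h0 : ∀ k, ¬ zigzag x y z (k + 1) ≤ zigzag x y z k := by
    intro k
    induction k with
    | zero => exact H.not_le False True True (fun h hx hy hz hs hA => by
          simp [hx, hy, hz, hs, zigzag_zero])
    | succ k ih => exact fun h => ih (step2 k (step1 k h))
  exact ⟨h0 k, fun h => h0 k (step2 k h)⟩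

/-- Take `w i = s (i + 1) ⊓ t i` with `s` strictly ascending and `t` strictly descending. By (W),
dependence would put `s (i + 1)` or `t i` under the join, which `x` and `y` forbid, or `w i` under
some `w j`: the chain `s` excludes `j < i` and the chain `t` excludes `j > i`. -/
theorem exists_join_independent (hM : Whitman M) {x y z : M} (H : FreeTriple x y z) :
    ∃ w : ℕ → M, ∀ i N, ∃ u, ¬ w i ≤ u ∧ ∀ j < N, j ≠ i → w j ≤ u := by
  obtain ⟨t, c, ht, htm, hts, hcz, hzc⟩ : ∃ t c : ℕ → M, (∀ k, t k = y ⊔ c k) ∧ Antitone t ∧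
      (∀ k, ¬ t k ≤ t (k + 1)) ∧ (∀ k, c k ≤ z) ∧ ∀ k, z ⊓ x ≤ c k :=
    ⟨_, _, fun k => congrArg OrderDual.ofDual (zigzagBelow_def (OrderDual.toDual y)
        (OrderDual.toDual z) (OrderDual.toDual x) k),
      zigzagBelow_mono (OrderDual.toDual y) (OrderDual.toDual z) (OrderDual.toDual x),
      fun k => (zigzag_strict hM.dual H.rotate.dual k).2, fun k => inf_le_left,
      fun k => inf_le_inf_left z le_sup_left⟩
  have hyt : ∀ k, y ≤ t k := fun k => (ht k).symm ▸ le_sup_left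
  have hxt : ∀ k, ¬ x ≤ t k := fun k h => H.not_le True False False
    (fun h hx hy hz hs hA => by simp [hx, hy, hz]) (h.trans ((ht k).le.trans (sup_le_sup_left (hcz k) y)))
  have hys : ∀ k, ¬ y ≤ zigzag x y z k := fun k h => H.not_le False True False
    (fun h hx hy hz hs hA => by simp [hy, hs]) (h.trans (zigzag_mono x y z k.le_succ))
  have hxs : ∀ k, x ≤ zigzag x y z k := fun k => zigzag_mono x y z k.zero_le
  have hwx : ∀ i j, ¬ zigzag x y z (i + 1) ⊓ t j ≤ x := fun i j h => H.not_le False True True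
    (fun h hx hy hz hs hA => by simp [hx, hy, hs]) ((inf_le_inf_left _ (hyt j)).trans h)
  have hwy : ∀ i j, ¬ zigzag x y z i ⊓ t j ≤ y := fun i j h => H.not_le True False True
    (fun h hx hy hz hs hA => by simp [hx, hy, hz])
      ((inf_le_inf (hxs i) ((hzc j).trans (le_sup_right.trans (ht j).ge))).trans h)
  have hwz : ∀ i j, ¬ zigzag x y z i ⊓ t j ≤ z := fun i j h => H.not_le True True False
    (fun h hx hy hz hs hA => by simp [hx, hy, hz]) ((inf_le_inf (hxs i) (hyt j)).trans h)
  -- The shift to `i + 1` matters: `zigzag` at `0` is `x`, whereas `hwx` needs elements not below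
  -- `x`.
  refine ⟨fun i => zigzag x y z (i + 1) ⊓ t i, fun i N => ?_⟩
  have hU : ((Finset.range (N + i + 2)).erase i).Nonempty :=
    ⟨i + 1, by simp⟩
  refine ⟨((Finset.range (N + i + 2)).erase i).sup' hU fun i => zigzag x y z (i + 1) ⊓ t i,
    fun h => ?_, fun j hj hji => Finset.le_sup' (fun i => zigzag x y z (i + 1) ⊓ t i)
      (Finset.mem_erase.mpr ⟨hji, Finset.mem_range.mpr (by omega)⟩)⟩
  rcases hM.inf_le_sup' hU _ h with h | h | ⟨j, hj, h⟩
  · refine hxt 0 ((hxs _).trans (h.trans (Finset.sup'_le hU _ fun j _ => ?_)))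
    exact inf_le_right.trans (htm j.zero_le)
  · refine hys (N + i + 3) ((hyt i).trans (h.trans (Finset.sup'_le hU _ fun j hj => ?_)))
    refine inf_le_left.trans (zigzag_mono x y z ?_)
    have := Finset.mem_range.mp (Finset.mem_of_mem_erase hj)
    omega
  · rcases lt_or_gt_of_ne (Finset.ne_of_mem_erase hj) with hji | hij
    · rcases hM _ _ _ _ (h.trans inf_le_left) with h | h | h | h
      · exact (zigzag_strict hM H (j + 1)).1 ((zigzag_mono x y z (by omega)).trans h)
      · exact hys (j + 1) ((hyt i).trans h)
      · exact hwx i i h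
      · exact hwy (i + 1) i (h.trans inf_le_left)
    · have h' := h.trans inf_le_right
      rw [ht j] at h'
      rcases hM _ _ _ _ h' with h | h | h | h
      · exact hxt j ((hxs (i + 1)).trans (h.trans (ht j).ge))
      · exact hts i (h.trans ((ht j).ge.trans (htm hij)))
      · exact hwy (i + 1) i h
      · exact hwz (i + 1) i (h.trans (hcz j))

theorem exists_independent (hM : Whitman M) {x y z : M} (H : FreeTriple x y z) (n : ℕ) :
    ∃ w : Fin n → M, (∀ i, ∃ u, ¬ w i ≤ u ∧ ∀ j, j ≠ i → w j ≤ u) ∧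
      ∀ i, ∃ u, ¬ u ≤ w i ∧ ∀ j, j ≠ i → u ≤ w j := by
  obtain ⟨w, hw⟩ := exists_join_independent hM H
  -- The common part `w 0 ⊔ w 1` gives meet independence: it lies below the meet of the other
  -- members, and so blocks the cases of (W) in which this meet is below one of the joinands.
  refine ⟨fun i => w 0 ⊔ w 1 ⊔ w (i + 2), fun i => ?_, fun i => ?_⟩
  · obtain ⟨u, hu, hu'⟩ := hw (i + 2) (n + 2)
    refine ⟨u, fun h => hu (le_sup_right.trans h), fun j hji => sup_le (sup_le ?_ ?_) ?_⟩
    · exact hu' 0 (by omega) (by omega)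
    · exact hu' 1 (by omega) (by omega)
    · exact hu' (j + 2) (by omega) (by omega)
  -- One index beyond `Fin n` keeps the meet nonempty even for `n = 1`.
  · have hU : ((Finset.range (n + 1)).erase i).Nonempty := ⟨n, by simp; omega⟩
    refine ⟨((Finset.range (n + 1)).erase i).inf' hU fun j => w 0 ⊔ w 1 ⊔ w (j + 2), fun h => ?_,
      fun j hji => Finset.inf'_le (fun j => w 0 ⊔ w 1 ⊔ w (j + 2))
        (Finset.mem_erase.mpr ⟨by omega, Finset.mem_range.mpr (by omega)⟩)⟩
    have h0 : ¬ w 0 ≤ w 1 ⊔ w (i + 2) := fun k => by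
      obtain ⟨u, hu, hu'⟩ := hw 0 (i + 3)
      exact hu (k.trans (sup_le (hu' _ (by omega) (by omega)) (hu' _ (by omega) (by omega))))
    have h1 : ¬ w 1 ≤ w 0 := fun k => by
      obtain ⟨u, hu, hu'⟩ := hw 1 1
      exact hu (k.trans (hu' _ (by omega) (by omega)))
    have hl0 : w 0 ≤ ((Finset.range (n + 1)).erase i).inf' hU fun j => w 0 ⊔ w 1 ⊔ w (j + 2) :=
      Finset.le_inf' hU _ fun j _ => le_sup_left.trans le_sup_left
    have hl1 : w 1 ≤ ((Finset.range (n + 1)).erase i).inf' hU fun j => w 0 ⊔ w 1 ⊔ w (j + 2) :=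
      Finset.le_inf' hU _ fun j _ => le_sup_right.trans le_sup_left
    have h2 : ∀ j ∈ (Finset.range (n + 1)).erase i,
        ¬ w 0 ⊔ w 1 ⊔ w (j + 2) ≤ w 0 ⊔ w 1 ⊔ w (i + 2) := fun j hj k => by
      have := Finset.ne_of_mem_erase hj
      obtain ⟨u, hu, hu'⟩ := hw (j + 2) (i + 3)
      exact hu (le_sup_right.trans (k.trans (sup_le (sup_le (hu' _ (by omega) (by omega))
        (hu' _ (by omega) (by omega))) (hu' _ (by omega) (by omega)))))
    rcases hM.inf'_le_sup hU _ h with h | h | ⟨j, hj, h⟩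
    · rcases hM.inf'_le_sup hU _ h with h | h | ⟨j, hj, h⟩
      · exact h1 (hl1.trans h)
      · exact h0 (hl0.trans (h.trans le_sup_left))
      · exact h2 j hj (h.trans le_sup_left)
    · exact h0 (hl0.trans (h.trans le_sup_right))
    · exact h2 j hj h

end Zigzag

theorem freeTriple_F3 : FreeTriple (M := F3) (FreeLatticeOn.mk (.var 0))
    (FreeLatticeOn.mk (.var 1)) (FreeLatticeOn.mk (.var 2)) := by
  intro P Q R
  exact ⟨FreeLatticeOn.lift ![P, Q, R], Iff.rfl, Iff.rfl, Iff.rfl⟩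

/-- The dual of the free lattice on three generators contains the free lattice on `n` generators. -/
theorem exists_embedding_dual_F3 (n : ℕ) : ∃ g : LatticeHom (FreeLatticeOn (Fin n)) F3ᵒᵈ,
    ∀ p q, g p ≤ g q → p ≤ q := by
  obtain ⟨w, hj, hm⟩ := exists_independent (FreeLatticeOn.whitman (X := Fin 3)).dual
    freeTriple_F3.dual n
  exact ⟨FreeLatticeOn.lift w, fun p q =>
    FreeLatticeOn.le_of_lift_le (FreeLatticeOn.whitman (X := Fin 3)).dual hj hm⟩

/-! ### Joins of pure tensors and lattice polynomials -/

section Fraser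

variable {A : Type u} {B : Type v} [Lattice A] [OrderBot A] [Lattice B] [OrderBot B]

/-- The join of the tensors `aᵢ ⊗ bᵢ` is described by lattice polynomials and their duals. -/
theorem exists_term_fraser {X : Type w} [Fintype X] (e : LatticeHom (FreeLatticeOn X) A)
    (g : LatticeHom (FreeLatticeOn X) Bᵒᵈ) :
    ∃ τ : TensorTerm A B, (∀ p, tens (e p) (OrderDual.ofDual (g p)) ≤ τ) ∧
      ∀ x y, x ≠ ⊥ → y ≠ ⊥ → tens x y ≤ τ → ∃ p, x ≤ e p ∧ y ≤ OrderDual.ofDual (g p) := by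
  classical
  obtain ⟨τ, hτ, hg⟩ := exists_term_of_finset
    (Finset.univ.image fun x : X => (e (.mk (.var x)), OrderDual.ofDual (g (.mk (.var x)))))
  have hτ' := (hτ τ).mp le_rfl
  refine ⟨τ, fun p => ?_, fun x y hx hy h => ?_⟩
  · induction p using FreeLatticeOn.induction with
    | var x => exact hτ' _ (Finset.mem_image_of_mem _ (Finset.mem_univ x))
    | sup p q hp hq =>
      rw [map_sup, map_sup]
      exact tens_sup_left_le ((tens_mono le_rfl inf_le_left).trans hp)
        ((tens_mono le_rfl inf_le_right).trans hq)
    | inf p q hp hq =>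
      rw [map_inf, map_inf]
      exact tens_sup_right_le ((tens_mono inf_le_left le_rfl).trans hp)
        ((tens_mono inf_le_right le_rfl).trans hq)
  · have hI : IsBiIdeal fun (x : A) (y : B) => ∃ p, x ≤ e p ∧ y ≤ OrderDual.ofDual (g p) := by
      refine ⟨?_, ?_, ?_⟩
      · rintro a a' b b' ha hb ⟨p, h1, h2⟩
        exact ⟨p, ha.trans h1, hb.trans h2⟩
      · rintro a a' b ⟨p, h1, h2⟩ ⟨q, h3, h4⟩
        refine ⟨p ⊔ q, ?_, ?_⟩
        · rw [map_sup]; exact sup_le_sup h1 h3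
        · rw [map_sup]; exact le_inf h2 h4
      · rintro a b b' ⟨p, h1, h2⟩ ⟨q, h3, h4⟩
        refine ⟨p ⊓ q, ?_, ?_⟩
        · rw [map_inf]; exact le_inf h1 h3
        · rw [map_inf]; exact sup_le_sup h2 h4
    refine hI.of_tens_le (fun i hi => ?_) hx hy h
    obtain ⟨x, -, rfl⟩ := Finset.mem_image.mp (hg hi)
    exact ⟨_, le_rfl, le_rfl⟩

end Fraser

/-! ### Amenability implies local finiteness -/

section LocallyFinite

variable {F : Type w} [Lattice F]

/-- The sets `Z` of elements of two copies of a lattice, such that the second part of `Z` is a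
(possibly empty) filter that is contained in the first part. -/
structure IsDoubleFilter (Z : Set (F ⊕ F)) : Prop where
  inl_mem : ∀ {p}, Sum.inr p ∈ Z → Sum.inl p ∈ Z
  upper : ∀ {p q}, p ≤ q → Sum.inr p ∈ Z → Sum.inr q ∈ Z
  inf_mem : ∀ {p q}, Sum.inr p ∈ Z → Sum.inr q ∈ Z → Sum.inr (p ⊓ q) ∈ Z

variable (F) in
/-- The lattice of double filters. -/
abbrev DoubleFilter : Type w := {Z : Set (F ⊕ F) // IsDoubleFilter Z}

namespace DoubleFilter

instance : InfSet (DoubleFilter F) where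
  sInf S := ⟨{x | ∀ Z ∈ S, x ∈ Z.1}, fun h Z hZ => Z.2.inl_mem (h Z hZ),
    fun hpq h Z hZ => Z.2.upper hpq (h Z hZ), fun h h' Z hZ => Z.2.inf_mem (h Z hZ) (h' Z hZ)⟩

instance : CompleteLattice (DoubleFilter F) :=
  completeLatticeOfInf _ fun _ => ⟨fun Z hZ _ hx => hx Z hZ, fun _ hZ _ hx _ hZ' => hZ hZ' hx⟩

/-- The double filters without elements of the second copy. -/
def left (S : Set F) : DoubleFilter F :=
  ⟨Sum.inl '' S, by simp, by simp, by simp⟩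

/-- The double filter of the elements above `p`. -/
def principal (p : F) : DoubleFilter F :=
  ⟨{x | x.elim (p ≤ ·) (p ≤ ·)}, fun h => h, fun h k => le_trans k h, fun h k => le_inf h k⟩

theorem principal_anti {p q : F} (h : p ≤ q) : principal q ≤ principal p := by
  rintro (x | x) hx
  · exact h.trans hx
  · exact h.trans hx

theorem principal_sup (p q : F) : principal (p ⊔ q) = principal p ⊓ principal q := by
  refine le_antisymm (le_inf (principal_anti le_sup_left) (principal_anti le_sup_right)) ?_
  intro x hx
  have h1 : x ∈ (principal p).1 := (inf_le_left : principal p ⊓ principal q ≤ _) hx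
  have h2 : x ∈ (principal q).1 := (inf_le_right : principal p ⊓ principal q ≤ _) hx
  rcases x with x | x
  · exact sup_le h1 h2
  · exact sup_le h1 h2

theorem principal_inf (p q : F) : principal (p ⊓ q) = principal p ⊔ principal q := by
  refine le_antisymm ?_ (sup_le (principal_anti inf_le_left) (principal_anti inf_le_right))
  have h1 : Sum.inr p ∈ (principal p ⊔ principal q).1 :=
    (le_sup_left : principal p ≤ principal p ⊔ principal q) (le_refl p)
  have h2 : Sum.inr q ∈ (principal p ⊔ principal q).1 :=
    (le_sup_right : principal q ≤ principal p ⊔ principal q) (le_refl q)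
  have h3 := (principal p ⊔ principal q).2.inf_mem h1 h2
  rintro (x | x) hx
  · exact (principal p ⊔ principal q).2.inl_mem ((principal p ⊔ principal q).2.upper hx h3)
  · exact (principal p ⊔ principal q).2.upper hx h3

/-- The map that takes `p` to its principal double filter. -/
def principalHom : LatticeHom F (DoubleFilter F)ᵒᵈ where
  toFun p := OrderDual.toDual (principal p)
  map_sup' p q := congrArg OrderDual.toDual (principal_sup p q)
  map_inf' p q := congrArg OrderDual.toDual (principal_inf p q)

theorem left_le_principal {p q : F} : left {q} ≤ principal p ↔ p ≤ q := by
  refine ⟨fun h => h (show Sum.inl q ∈ _ from ⟨q, rfl, rfl⟩), ?_⟩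
  rintro h _ ⟨_, rfl, rfl⟩
  exact h

theorem left_singleton_le {Z : DoubleFilter F} {q : F} : left {q} ≤ Z ↔ Sum.inl q ∈ Z.1 := by
  refine ⟨fun h => h ⟨q, rfl, rfl⟩, ?_⟩
  rintro h _ ⟨_, rfl, rfl⟩
  exact h

theorem left_singleton_ne_bot (q : F) : left {q} ≠ ⊥ := by
  intro h
  obtain ⟨_, h', _⟩ := left_singleton_le.mp (h.le.trans (bot_le (a := left ∅)))
  exact h'

/-- Without elements of the second copy the filter conditions are void, so joins are unions. -/
theorem sup_subset_of_le_left {S : Set F} {Z Z' : DoubleFilter F} (h : Z ≤ left S)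
    (h' : Z' ≤ left S) : (Z ⊔ Z').1 ⊆ Z.1 ∪ Z'.1 := by
  have hn : ∀ x, Sum.inr x ∉ Z.1 ∪ Z'.1 := by
    rintro x (hx | hx)
    · obtain ⟨_, _, k⟩ := h hx
      cases k
    · obtain ⟨_, _, k⟩ := h' hx
      cases k
  exact (sup_le (fun x hx => .inl hx) (fun x hx => .inr hx) : Z ⊔ Z' ≤ ⟨Z.1 ∪ Z'.1,
    fun k => (hn _ k).elim, fun _ k => (hn _ k).elim, fun k => (hn _ k).elim⟩)

end DoubleFilter

theorem FreeLatticeOn.latticeClosure_subset_range_lift {X : Type w} {A : Type u} [Lattice A]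
    (a : X → A) : latticeClosure (Set.range a) ⊆ Set.range (FreeLatticeOn.lift a) := by
  refine latticeClosure_min ?_ ⟨?_, ?_⟩
  · rintro _ ⟨x, rfl⟩
    exact ⟨_, FreeLatticeOn.lift_var a x⟩
  · rintro _ ⟨p, rfl⟩ _ ⟨q, rfl⟩
    exact ⟨p ⊔ q, map_sup _ _ _⟩
  · rintro _ ⟨p, rfl⟩ _ ⟨q, rfl⟩
    exact ⟨p ⊓ q, map_inf _ _ _⟩

/-- The second copy makes `principal` turn meets into joins; the first copy only observes. Cutting
`τ` down to the first copy leaves, over the singleton of `z`, exactly the elements of `A` below `e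
z`. -/
theorem isLocallyFiniteLattice_of_tensor {A : Type u} [Lattice A] [OrderBot A]
    (h : ∀ (B : Type) [Lattice B] [OrderBot B], IsLatticeOrder (SemilatticeTensor A B)) :
    IsLocallyFiniteLattice A := by
  classical
  intro s hs
  obtain ⟨n, a, rfl⟩ : ∃ (n : ℕ) (a : Fin n → A), Set.range a = s := by
    have := hs.to_subtype
    obtain ⟨n, ⟨f⟩⟩ := Finite.exists_equiv_fin s
    exact ⟨n, fun i => f.symm i, by
      rw [Set.range_comp' Subtype.val f.symm, f.symm.surjective.range_eq]; simp⟩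
  refine Set.Finite.subset ?_ (FreeLatticeOn.latticeClosure_subset_range_lift a)
  set e := FreeLatticeOn.lift a with he
  obtain ⟨τ, hτ1, hτ2⟩ := exists_term_fraser e DoubleFilter.principalHom
  let c : A := Finset.univ.sup a
  have hc : ∀ p, e p ≤ c := by
    intro p
    induction p using FreeLatticeOn.induction with
    | var x => exact Finset.le_sup (f := a) (Finset.mem_univ x)
    | sup p q hp hq => rw [map_sup]; exact sup_le hp hq
    | inf p q hp hq => rw [map_inf]; exact inf_le_left.trans hp
  let D : DoubleFilter (FreeLatticeOn (Fin n)) := DoubleFilter.left Set.univ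
  have hD : ∀ q, DoubleFilter.left {q} ≤ D := by
    rintro q _ ⟨_, rfl, rfl⟩
    exact ⟨_, trivial, rfl⟩
  obtain ⟨ρ, hρ⟩ := isLatticeOrder_tensor_iff.mp
    (h (DoubleFilter (FreeLatticeOn (Fin n)))) τ (tens c D)
  -- As `k z` depends only on a subset of the finite set `ρ.gens`, the identity `e z = k z` bounds
  -- the range of `e`.
  let k : FreeLatticeOn (Fin n) → A := fun z => (ρ.gens.filter fun g => Sum.inl z ∈ g.2.1).sup
    Prod.fst
  have hgD : ∀ g ∈ ρ.gens, g.2 ≤ D := by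
    intro g hg
    have h1 := ((hρ g.1 g.2).mp (TensorTerm.tens_le_of_mem_gens hg)).2
    have hn := TensorTerm.ne_bot_of_mem_gens hg
    have hI : IsBiIdeal fun (_ : A) (y : DoubleFilter (FreeLatticeOn (Fin n))) => y ≤ D :=
      ⟨fun _ h h' => h.trans h', fun h _ => h, sup_le⟩
    refine hI.of_tens_le (fun i hi => ?_) hn.1 hn.2 h1
    have := Finset.mem_singleton.mp (gens_tens_subset c D hi)
    rw [this]
  have hI : IsBiIdeal fun (x : A) (Z : DoubleFilter (FreeLatticeOn (Fin n))) =>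
      Z ≤ D ∧ ∀ z, Sum.inl z ∈ Z.1 → x ≤ k z := by
    refine ⟨?_, ?_, ?_⟩
    · rintro x x' Z Z' hx hZ ⟨h1, h2⟩
      exact ⟨hZ.trans h1, fun z hz => hx.trans (h2 z (hZ hz))⟩
    · rintro x x' Z ⟨h1, h2⟩ ⟨_, h4⟩
      exact ⟨h1, fun z hz => sup_le (h2 z hz) (h4 z hz)⟩
    · rintro x Z Z' ⟨h1, h2⟩ ⟨h3, h4⟩
      exact ⟨sup_le h1 h3, fun z hz =>
        (DoubleFilter.sup_subset_of_le_left h1 h3 hz).elim (h2 z) (h4 z)⟩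
  have hek : ∀ z, e z = k z := by
    intro z
    refine le_antisymm ?_ ?_
    · by_cases hz : e z = ⊥
      · rw [hz]; exact bot_le
      have h1 : tens (e z) (DoubleFilter.left {z}) ≤ ρ := (hρ _ _).mpr
        ⟨(tens_mono le_rfl (DoubleFilter.left_le_principal.mpr le_rfl)).trans (hτ1 z),
          tens_mono (hc z) (hD z)⟩
      refine (hI.of_tens_le (fun g hg => ⟨hgD g hg, fun z hz => ?_⟩) hz
        (DoubleFilter.left_singleton_ne_bot z) h1).2 z ⟨z, rfl, rfl⟩
      exact Finset.le_sup (f := Prod.fst) (Finset.mem_filter.mpr ⟨hg, hz⟩)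
    · refine Finset.sup_le fun g hg => ?_
      obtain ⟨hg, hz⟩ := Finset.mem_filter.mp hg
      have h1 := ((hρ g.1 g.2).mp (TensorTerm.tens_le_of_mem_gens hg)).1
      have hn := TensorTerm.ne_bot_of_mem_gens hg
      obtain ⟨p, hp, hp'⟩ := hτ2 _ _ hn.1 (DoubleFilter.left_singleton_ne_bot z)
        ((tens_mono le_rfl (DoubleFilter.left_singleton_le.mpr hz)).trans h1)
      exact hp.trans (OrderHomClass.mono e (DoubleFilter.left_le_principal.mp hp'))
  refine Set.Finite.subset (ρ.gens.powerset.image fun P => P.sup Prod.fst).finite_toSet ?_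
  rintro _ ⟨z, rfl⟩
  rw [hek]
  exact Finset.mem_coe.mpr (Finset.mem_image.mpr
    ⟨_, Finset.mem_powerset.mpr (Finset.filter_subset _ _), rfl⟩)

end LocallyFinite

/-! ### Optimal polynomials above the elements of a finite image -/

section Sections

variable {A : Type u} {B : Type v} [Lattice A] [OrderBot A] [Lattice B] [OrderBot B]

/-- Well-founded induction on `s` in the finite range of `e`. Intersecting the join `τ` with `s ⊗ γ
pb`, where `γ pb` is the largest value of `γ`, gives finitely many generators, hence finitely many
polynomials to combine by a meet. -/
theorem exists_least_of_isLatticeOrder_tensor {X : Type w} [Fintype X] [Nonempty X]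
    (e : LatticeHom (FreeLatticeOn X) A) (g : LatticeHom (FreeLatticeOn X) Bᵒᵈ)
    (he : (Set.range e).Finite) (h : IsLatticeOrder (SemilatticeTensor A B)) :
    ∀ s ∈ Set.range e, ∃ p₀, s ≤ e p₀ ∧ ∀ p, s ≤ e p → g p₀ ≤ g p := by
  classical
  obtain ⟨τ, hτ1, hτ2⟩ := exists_term_fraser e g
  obtain ⟨pb, hpb⟩ : ∃ pb : FreeLatticeOn X, ∀ p, pb ≤ p := by
    refine ⟨Finset.univ.inf' Finset.univ_nonempty fun x => .mk (.var x), fun p => ?_⟩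
    induction p using FreeLatticeOn.induction with
    | var x => exact Finset.inf'_le (fun x => FreeLatticeOn.mk (.var x)) (Finset.mem_univ x)
    | sup p q hp hq => exact hp.trans le_sup_left
    | inf p q hp hq => exact le_inf hp hq
  let γ : FreeLatticeOn X → B := fun p => OrderDual.ofDual (g p)
  have hγ : Antitone γ := fun p q hpq => OrderHomClass.mono g hpq
  have hγs : ∀ p q, γ (p ⊔ q) = γ p ⊓ γ q := fun p q => congrArg OrderDual.ofDual (map_sup g p q)
  have hsup : ∀ t t', t ∈ Set.range e → t' ∈ Set.range e → t ⊔ t' ∈ Set.range e := by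
    rintro _ _ ⟨p, rfl⟩ ⟨q, rfl⟩
    exact ⟨p ⊔ q, map_sup _ _ _⟩
  have hinf : ∀ t t', t ∈ Set.range e → t' ∈ Set.range e → t ⊓ t' ∈ Set.range e := by
    rintro _ _ ⟨p, rfl⟩ ⟨q, rfl⟩
    exact ⟨p ⊓ q, map_inf _ _ _⟩
  intro s hs
  change ∃ p₀, s ≤ e p₀ ∧ ∀ p, s ≤ e p → γ p ≤ γ p₀
  refine Set.WellFoundedOn.induction (r := (· < ·)) he.wellFoundedOn hs
    (P := fun s => ∃ p₀, s ≤ e p₀ ∧ ∀ p, s ≤ e p → γ p ≤ γ p₀) fun s hs ih => ?_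
  by_cases hs0 : s = ⊥
  · exact ⟨pb, by rw [hs0]; exact bot_le, fun p _ => hγ (hpb p)⟩
  obtain ⟨ps, hps⟩ := hs
  have : Nonempty (FreeLatticeOn X) := ⟨pb⟩
  choose! P hP1 hP2 using ih
  have hP3 : ∀ t ∈ Set.range e, t < s → ∀ p, t ≤ e p → γ p ≤ γ (P t) := hP2
  obtain ⟨ρ, hρ⟩ := isLatticeOrder_tensor_iff.mp h τ (tens s (γ pb))
  have hgs : ∀ k ∈ ρ.gens, k.1 ≤ s := by
    intro k hk
    have hn := TensorTerm.ne_bot_of_mem_gens hk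
    have hI : IsBiIdeal fun (x : A) (_ : B) => x ≤ s :=
      ⟨fun h _ h' => h.trans h', sup_le, fun h _ => h⟩
    refine hI.of_tens_le (fun i hi => ?_) hn.1 hn.2
      ((hρ k.1 k.2).mp (TensorTerm.tens_le_of_mem_gens hk)).2
    rw [Finset.mem_singleton.mp (gens_tens_subset _ _ hi)]
  have hgq : ∀ k ∈ ρ.gens, ∃ q, k.1 ≤ e q ∧ k.2 ≤ γ q := fun k hk =>
    hτ2 _ _ (TensorTerm.ne_bot_of_mem_gens hk).1 (TensorTerm.ne_bot_of_mem_gens hk).2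
      ((hρ k.1 k.2).mp (TensorTerm.tens_le_of_mem_gens hk)).1
  choose! q hq1 hq2 using hgq
  let T : Finset A := he.toFinset.filter (· < s)
  have hT : ∀ t, t ∈ T ↔ t ∈ Set.range e ∧ t < s := fun t => by
    rw [Finset.mem_filter, Set.Finite.mem_toFinset]
  -- Besides the polynomials behind the generators of `ρ`, include `P t ⊔ P t'`: these handle
  -- lateral joins with `t ⊔ t' = s`. The entry `ps` makes `Q` nonempty.
  let Q : Finset (FreeLatticeOn X) :=
    (insert ps (ρ.gens.image q ∪ Finset.image₂ (fun t t' => P t ⊔ P t') T T)).filter (s ≤ e ·)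
  have hQ : Q.Nonempty := ⟨ps, Finset.mem_filter.mpr ⟨Finset.mem_insert_self _ _, hps.ge⟩⟩
  have hp₀ : s ≤ e (Q.inf' hQ id) := by
    rw [map_finset_inf']
    exact Finset.le_inf' _ _ fun p hp => (Finset.mem_filter.mp hp).2
  have hp₀Q : ∀ p ∈ Q, γ p ≤ γ (Q.inf' hQ id) := fun p hp => hγ (Finset.inf'_le id hp)
  refine ⟨Q.inf' hQ id, hp₀, ?_⟩
  generalize Q.inf' hQ id = p₀ at hp₀ hp₀Q
  have hp₀T : ∀ t ∈ T, γ p₀ ≤ γ (P t) := fun t ht =>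
    hP3 t ((hT t).mp ht).1 ((hT t).mp ht).2 p₀ (((hT t).mp ht).2.le.trans hp₀)
  have hPT : ∀ t ∈ T, t ≤ e (P t) := fun t ht => hP1 t ((hT t).mp ht).1 ((hT t).mp ht).2
  -- This bi-ideal contains the generators of `ρ`, hence `(s, γ p)` whenever `s ≤ e p` and `γ p` is
  -- nonzero. Its first alternative needs `s ≤ t < s`, so `γ p ≤ γ p₀`.
  have hK : IsBiIdeal fun (x : A) (y : B) =>
      (∃ t ∈ T, x ≤ t ∧ y ≤ γ (P t)) ∨ (x ≤ s ∧ y ≤ γ p₀) := by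
    have hTs : ∀ t ∈ T, t ≤ s := fun t ht => ((hT t).mp ht).2.le
    refine ⟨?_, ?_, ?_⟩
    · rintro x x' y y' hx hy (⟨t, ht, h1, h2⟩ | ⟨h1, h2⟩)
      · exact .inl ⟨t, ht, hx.trans h1, hy.trans h2⟩
      · exact .inr ⟨hx.trans h1, hy.trans h2⟩
    · rintro x x' y (⟨t, ht, h1, h2⟩ | ⟨h1, h2⟩) (⟨t', ht', h3, h4⟩ | ⟨h3, h4⟩)
      · have hle : t ⊔ t' ≤ e (P t ⊔ P t') := by
          rw [map_sup]
          exact sup_le_sup (hPT t ht) (hPT t' ht')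
        have hy : y ≤ γ (P t ⊔ P t') := by
          rw [hγs]
          exact le_inf h2 h4
        rcases (sup_le (hTs t ht) (hTs t' ht')).lt_or_eq with hlt | heq
        · have hr := hsup t t' ((hT t).mp ht).1 ((hT t').mp ht').1
          exact .inl ⟨t ⊔ t', (hT _).mpr ⟨hr, hlt⟩, sup_le_sup h1 h3,
            hy.trans (hP3 _ hr hlt _ hle)⟩
        · refine .inr ⟨heq ▸ sup_le_sup h1 h3, hy.trans (hp₀Q _ (Finset.mem_filter.mpr ⟨?_, heq ▸ hle⟩))⟩
          exact Finset.mem_insert_of_mem (Finset.mem_union_right _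
            (Finset.mem_image₂_of_mem ht ht'))
      · exact .inr ⟨sup_le (h1.trans (hTs t ht)) h3, h4⟩
      · exact .inr ⟨sup_le h1 (h3.trans (hTs t' ht')), h2⟩
      · exact .inr ⟨sup_le h1 h3, h2⟩
    · rintro x y y' (⟨t, ht, h1, h2⟩ | ⟨h1, h2⟩) (⟨t', ht', h3, h4⟩ | ⟨h3, h4⟩)
      · have hr := hinf t t' ((hT t).mp ht).1 ((hT t').mp ht').1
        have hlt : t ⊓ t' < s := inf_le_left.trans_lt ((hT t).mp ht).2
        exact .inl ⟨t ⊓ t', (hT _).mpr ⟨hr, hlt⟩, le_inf h1 h3, sup_le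
          (h2.trans (hP3 _ hr hlt _ (inf_le_left.trans (hPT t ht))))
          (h4.trans (hP3 _ hr hlt _ (inf_le_right.trans (hPT t' ht'))))⟩
      · exact .inl ⟨t, ht, h1, sup_le h2 (h4.trans (hp₀T t ht))⟩
      · exact .inl ⟨t', ht', h3, sup_le (h2.trans (hp₀T t' ht')) h4⟩
      · exact .inr ⟨h1, sup_le h2 h4⟩
  intro p hp
  by_cases hp0 : γ p = ⊥
  · rw [hp0]; exact bot_le
  have h1 : tens s (γ p) ≤ ρ := (hρ _ _).mpr
    ⟨(tens_mono hp le_rfl).trans (hτ1 p), tens_mono le_rfl (hγ (hpb p))⟩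
  have hKρ : ∀ k ∈ ρ.gens, (∃ t ∈ T, k.1 ≤ t ∧ k.2 ≤ γ (P t)) ∨ (k.1 ≤ s ∧ k.2 ≤ γ p₀) := by
    intro k hk
    rcases (inf_le_right : e (q k) ⊓ s ≤ s).lt_or_eq with hlt | heq
    · have hr := hinf _ _ ⟨q k, rfl⟩ ⟨ps, hps⟩
      exact .inl ⟨_, (hT _).mpr ⟨hr, hlt⟩, le_inf (hq1 k hk) (hgs k hk),
        (hq2 k hk).trans (hP3 _ hr hlt _ inf_le_left)⟩
    · refine .inr ⟨hgs k hk, (hq2 k hk).trans (hp₀Q _ (Finset.mem_filter.mpr ⟨?_, ?_⟩))⟩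
      · exact Finset.mem_insert_of_mem (Finset.mem_union_left _ (Finset.mem_image_of_mem _ hk))
      · exact inf_eq_right.mp heq
  rcases hK.of_tens_le hKρ hs0 hp0 h1 with ⟨t, ht, h2, -⟩ | h2
  · exact absurd ((hT t).mp ht).2 h2.not_gt
  · exact h2.2

end Sections

/-! ### Lower bounded images of free lattices satisfy `(T_∨)` -/

section LowerBounded

variable {L : Type u} [Lattice L]

theorem leJoin_iff [Finite L] {p : L} {I : Set L} :
    LeJoin p I ↔ ∀ u ∈ upperBounds I, p ≤ u := by
  classical
  refine ⟨fun ⟨s, hs, h⟩ u hu => h.trans (hs.2 hu), fun h => ?_⟩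
  obtain ⟨s, hs⟩ : ∃ s, IsLUB I s := by
    have := Fintype.ofFinite L
    have : Nonempty L := ⟨p⟩
    let _ := Fintype.toOrderBot L
    refine ⟨I.toFinset.sup id, fun i hi => Finset.le_sup (f := id) (Set.mem_toFinset.mpr hi),
      fun u hu => Finset.sup_le fun i hi => hu (Set.mem_toFinset.mp hi)⟩
  exact ⟨s, hs, h s hs.1⟩

theorem le_of_forall_supIrred_le [Finite L] {a b : L} (h : ∀ j, SupIrred j → j ≤ a → j ≤ b) :
    a ≤ b := by
  induction a using WellFoundedLT.induction with
  | ind a ih =>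
    by_cases ha : SupIrred a
    · exact h a ha le_rfl
    rcases (not_supIrred.mp ha) with ha | ⟨c, d, hcd, hc, hd⟩
    · exact (ha inf_le_left).trans inf_le_right
    · rw [← hcd]
      exact sup_le (ih c hc fun j hj hjc => h j hj (hjc.trans hc.le))
        (ih d hd fun j hj hjd => h j hj (hjd.trans hd.le))

theorem IsMinimalPair.eq_of_le [Finite L] {p : L} {I : Set L} (h : IsMinimalPair p I) {i j : L}
    (hi : i ∈ I) (hj : j ∈ I) (hij : i ≤ j) : i = j := by
  by_contra hne
  have := h.minimal (I \ {i}) (fun k hk => h.subset_supIrred k hk.1)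
    (fun k hk => ⟨k, hk.1, le_rfl⟩) (leJoin_iff.mpr fun u hu => leJoin_iff.mp h.le_join u ?_) hi
  · exact this.2 rfl
  · intro k hk
    by_cases hki : k = i
    · exact hki ▸ hij.trans (hu ⟨hj, fun k => hne k.symm⟩)
    · exact hu ⟨hk, hki⟩

theorem IsMinimalPair.not_le {p : L} {I : Set L} (h : IsMinimalPair p I) {i : L}
    (hi : i ∈ I) : ¬ p ≤ i := by
  intro hpi
  have := h.minimal {p} (by simpa using h.supIrred) (by rintro _ rfl; exact ⟨i, hi, hpi⟩)
    ⟨p, isLUB_singleton, le_rfl⟩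
  obtain rfl := this hi
  exact h.notMem hi

/-- A finite lattice in which minimal pairs decrease a rank satisfies (T). -/
theorem satisfiesTJoin_of_rank [Finite L] (r : L → ℕ)
    (hr : ∀ p I, IsMinimalPair p I → ∀ j ∈ I, r j < r p) : SatisfiesTJoin L := by
  obtain ⟨n, ⟨f⟩⟩ := Finite.exists_equiv_fin {a : L // SupIrred a}
  -- Higher rank comes first; the enumeration `f` only breaks ties.
  let φ : {a : L // SupIrred a} → ℕᵒᵈ ×ₗ Fin n := fun a => toLex (OrderDual.toDual (r a.1), f a)
  have hφ : Function.Injective φ := fun a b h => f.injective (congrArg (fun x => (ofLex x).2) h)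
  refine ⟨LinearOrder.lift' φ hφ, fun p j I hI hj => ?_⟩
  change φ p ≤ φ j
  exact Prod.Lex.le_iff.mpr (.inl (hr p.1 I hI j.1 hj))

/-- The least preimages `β` preserve join covers, so a minimal pair `⟨p, I⟩` gives `β p ≤ ⋁ β i`.
Refining this cover by terms shorter than the one for `β p`, minimality forces each `β q` with `q ∈
I` to be among them. -/
theorem satisfiesTJoin_of_lowerBounded [Finite L] {X : Type w}
    (e : LatticeHom (FreeLatticeOn X) L) (he : Function.Surjective e)
    (h : ∀ s, ∃ p₀, ∀ p, p₀ ≤ p ↔ s ≤ e p) : SatisfiesTJoin L := by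
  classical
  choose β hβ using h
  have hβ1 : ∀ s, s ≤ e (β s) := fun s => (hβ s _).mp le_rfl
  have hβ2 : ∀ s, e (β s) = s := by
    intro s
    obtain ⟨p, rfl⟩ := he s
    exact le_antisymm (OrderHomClass.mono e ((hβ _ _).mpr le_rfl)) (hβ1 _)
  have hex : ∀ s, ∃ n, ∃ t : LatticeTerm X, FreeLatticeOn.mk t = β s ∧ t.size = n := fun s => by
    obtain ⟨t, ht⟩ := FreeLatticeOn.exists_mk_eq (β s)
    exact ⟨_, t, ht, rfl⟩
  refine satisfiesTJoin_of_rank (fun s => Nat.find (hex s)) fun p I hI q hq => ?_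
  obtain ⟨t, ht, htn⟩ := Nat.find_spec (hex p)
  have hIf : I.Finite := Set.toFinite I
  have hU : (hIf.toFinset.image β).Nonempty := ⟨β q, Finset.mem_image_of_mem _ (by simpa using hq)⟩
  have hcover : FreeLatticeOn.mk t ≤ (hIf.toFinset.image β).sup' hU id := by
    rw [ht, hβ]
    refine leJoin_iff.mp hI.le_join _ fun i hi => (hβ i _).mp ?_
    exact Finset.le_sup' id (Finset.mem_image_of_mem _ (by simpa using hi))
  rcases FreeLatticeOn.exists_refinement hU t hcover with ⟨u, hu, htu⟩ | ⟨V, hV, htV, hVs⟩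
  · obtain ⟨i, hi, rfl⟩ := Finset.mem_image.mp hu
    rw [ht, hβ, hβ2] at htu
    exact (hI.not_le (by simpa using hi) htu).elim
  have hVI : ∀ v ∈ V, ∃ i ∈ I, FreeLatticeOn.mk v ≤ β i := fun v hv => by
    obtain ⟨u, hu, hvu⟩ := (hVs v hv).2
    obtain ⟨i, hi, rfl⟩ := Finset.mem_image.mp hu
    exact ⟨i, by simpa using hi, hvu⟩
  have hJI : IsDominatedBy {j | SupIrred j ∧ ∃ v ∈ V, j ≤ e (.mk v)} I := by
    rintro j ⟨hj, v, hv, hjv⟩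
    obtain ⟨i, hi, hvi⟩ := hVI v hv
    exact ⟨i, hi, hjv.trans ((OrderHomClass.mono e hvi).trans (hβ2 i).le)⟩
  have hpJ : LeJoin p {j | SupIrred j ∧ ∃ v ∈ V, j ≤ e (.mk v)} := by
    refine leJoin_iff.mpr fun z hz => ?_
    rw [ht] at htV
    refine ((hβ _ _).mp htV).trans ?_
    rw [map_finset_sup']
    exact Finset.sup'_le _ _ fun v hv => le_of_forall_supIrred_le fun j hj hjv =>
      hz ⟨hj, v, hv, hjv⟩
  obtain ⟨-, v, hv, hqv⟩ := hI.minimal _ (fun j hj => hj.1) hJI hpJ hq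
  obtain ⟨i, hi, hvi⟩ := hVI v hv
  have hei : e (.mk v) ≤ i := (OrderHomClass.mono e hvi).trans (hβ2 i).le
  -- Since `I` is an antichain, the `β i` above `v` is `β q` itself, which pins `v` to `β q`.
  obtain rfl := hI.eq_of_le hq hi (hqv.trans hei)
  have hvq : FreeLatticeOn.mk v = β q := le_antisymm hvi ((hβ _ _).mpr hqv)
  exact (Nat.find_min' (hex q) ⟨v, hvq, rfl⟩).trans_lt ((hVs v hv).1.trans_eq htn)

/-- All elements of `S` serve as generators. Because `g` reflects the order, optimality in `F(3)`
means that `p₀` is least in the free lattice. -/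
theorem satisfiesTJoin_of_isLatticeOrder_tensor_F3 {A : Type u} [Lattice A] [OrderBot A]
    (h : IsLatticeOrder (SemilatticeTensor A F3)) (S : Sublattice A) [Finite S] :
    SatisfiesTJoin S := by
  obtain ⟨n, ⟨f⟩⟩ := Finite.exists_equiv_fin S
  obtain ⟨g, hg⟩ := exists_embedding_dual_F3 n
  have hsurj : Function.Surjective (FreeLatticeOn.lift f.symm) := fun s =>
    ⟨.mk (.var (f s)), by rw [FreeLatticeOn.lift_var, f.symm_apply_apply]⟩
  refine satisfiesTJoin_of_lowerBounded (FreeLatticeOn.lift f.symm) hsurj fun s => ?_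
  have : Nonempty (Fin n) := ⟨f s⟩
  let e : LatticeHom (FreeLatticeOn (Fin n)) A :=
    (Sublattice.subtype S).comp (FreeLatticeOn.lift f.symm)
  have he : Set.range e ⊆ S := by
    rintro _ ⟨p, rfl⟩
    exact (FreeLatticeOn.lift f.symm p).2
  obtain ⟨p, hp⟩ := hsurj s
  obtain ⟨p₀, h1, h2⟩ := exists_least_of_isLatticeOrder_tensor e g
    ((Set.toFinite (S : Set A)).subset he) h s.1 ⟨p, congrArg Subtype.val hp⟩
  exact ⟨p₀, fun p => ⟨fun k => le_trans (b := FreeLatticeOn.lift f.symm p₀) h1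
    (OrderHomClass.mono _ k), fun k => hg _ _ (h2 p k)⟩⟩

end LowerBounded

/-! ### Minimal pairs in finite lattices and the rank given by `(T_∨)` -/

section MinimalPairs

variable {L : Type u} [Lattice L] [Finite L]

/-- A nontrivial join cover of a join-irreducible element is refined by a minimal pair. -/
theorem exists_isMinimalPair {p : L} (hp : SupIrred p) {X : Set L} (hX : LeJoin p X)
    (hpX : ∀ x ∈ X, ¬ p ≤ x) : ∃ I, IsMinimalPair p I ∧ IsDominatedBy I X := by
  -- Covers are compared through the down-sets of join-irreducibles they generate; the maximal
  -- elements of an inclusion-minimal such `D` form the required `I`.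
  let 𝓓 : Set (Set L) := {D | (∀ j ∈ D, SupIrred j ∧ ∃ x ∈ X, j ≤ x) ∧
    (∀ j ∈ D, ∀ k, SupIrred k → k ≤ j → k ∈ D) ∧ LeJoin p D}
  have h𝓓 : 𝓓.Nonempty := by
    refine ⟨{j | SupIrred j ∧ ∃ x ∈ X, j ≤ x}, fun j hj => hj, ?_, leJoin_iff.mpr fun u hu => ?_⟩
    · rintro j ⟨-, x, hx, hjx⟩ k hk hkj
      exact ⟨hk, x, hx, hkj.trans hjx⟩
    · exact leJoin_iff.mp hX u fun x hx => le_of_forall_supIrred_le fun j hj hjx =>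
        hu ⟨hj, x, hx, hjx⟩
  obtain ⟨D, ⟨hD1, hD2, hD3⟩, hDm⟩ := (Set.toFinite 𝓓).exists_minimal h𝓓
  have hub : ∀ u ∈ upperBounds {i | Maximal (· ∈ D) i}, p ≤ u := fun u hu =>
    leJoin_iff.mp hD3 u fun j hj => by
      obtain ⟨i, hji, hi⟩ := (Set.toFinite D).exists_le_maximal hj
      exact hji.trans (hu hi)
  have hnot : ∀ i ∈ D, ¬ p ≤ i := fun i hi hpi => by
    obtain ⟨x, hx, hix⟩ := (hD1 i hi).2
    exact hpX x hx (hpi.trans hix)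
  refine ⟨{i | Maximal (· ∈ D) i}, ⟨hp, fun i hi => (hD1 i hi.1).1, ?_, fun h => hnot p h.1 le_rfl,
    leJoin_iff.mpr hub, fun J hJ hJI hpJ => ?_⟩, fun i hi => (hD1 i hi.1).2⟩
  · by_contra hn
    rcases (Set.not_nontrivial_iff.mp hn).eq_empty_or_singleton with h | ⟨i, h⟩
    · rw [h] at hub
      exact hp.not_isMin fun b _ => hub b (by simp)
    · have hi : Maximal (· ∈ D) i := by
        change i ∈ {i | Maximal (· ∈ D) i}
        rw [h]; rfl
      exact hnot i hi.1 (hub i (by rw [h]; simp))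
  · have hD' : {k | SupIrred k ∧ ∃ j ∈ J, k ≤ j} ⊆ D := by
      rintro k ⟨hk, j, hj, hkj⟩
      obtain ⟨i, hi, hji⟩ := hJI j hj
      exact hD2 i hi.1 k hk (hkj.trans hji)
    have hmem : {k | SupIrred k ∧ ∃ j ∈ J, k ≤ j} ∈ 𝓓 := by
      refine ⟨fun k hk => hD1 k (hD' hk), ?_, leJoin_iff.mpr fun u hu =>
        leJoin_iff.mp hpJ u fun j hj => hu ⟨hJ j hj, j, hj, le_rfl⟩⟩
      rintro k ⟨-, j, hj, hkj⟩ l hl hlk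
      exact ⟨hl, j, hj, hlk.trans hkj⟩
    intro i hi
    obtain ⟨-, j, hj, hij⟩ := hDm hmem hD' hi.1
    obtain rfl := hij.antisymm (hi.2 (hD' ⟨hJ j hj, j, hj, le_rfl⟩) hij)
    exact hj

theorem SatisfiesTJoin.exists_rank (h : SatisfiesTJoin L) :
    ∃ r : L → ℕ, ∀ p I, IsMinimalPair p I → ∀ j ∈ I, r j < r p := by
  classical
  obtain ⟨o, ho⟩ := h
  -- The number of join-irreducibles strictly after `a`, so that rank falls from `p` to `j ∈ I`.
  let r : {a : L // SupIrred a} → ℕ := fun a => {k | o.lt a k}.ncard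
  refine ⟨fun a => if ha : SupIrred a then r ⟨a, ha⟩ else 0, fun p I hI j hj => ?_⟩
  have hjI := hI.subset_supIrred j hj
  simp only [hI.supIrred, hjI, dif_pos]
  have hle := ho ⟨p, hI.supIrred⟩ ⟨j, hjI⟩ I hI hj
  have hlt : o.lt ⟨p, hI.supIrred⟩ ⟨j, hjI⟩ := by
    refine @lt_of_le_of_ne _ o.toPartialOrder _ _ hle fun h => hI.notMem ?_
    rw [show p = j from congrArg Subtype.val h]
    exact hj
  refine Set.ncard_lt_ncard ⟨fun k hk => @lt_trans _ o.toPreorder _ _ _ hlt hk, fun hs => ?_⟩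
  exact @lt_irrefl _ o.toPreorder _ (hs hlt)

end MinimalPairs

/-! ### Sufficiency of `(T_∨)`: adjusted sections and their meets -/

theorem exists_bounded_inf {B : Type v} [Lattice B] {ι : Type*} (u : B) (K : Finset ι) (f : ι → B) :
    ∃ v, ∀ y, y ≤ v ↔ y ≤ u ∧ ∀ p ∈ K, y ≤ f p := by
  classical
  induction K using Finset.induction_on with
  | empty => exact ⟨u, by simp⟩
  | insert i K _ ih =>
    obtain ⟨v, hv⟩ := ih
    exact ⟨f i ⊓ v, fun y => by simp [hv]; tauto⟩

section Adjustment

variable {L : Type u} [Lattice L] [Finite L] {B : Type v} [Lattice B] [OrderBot B]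

/-- The least function above `f₀` that is closed under the adjustments along join covers of
smaller rank. -/
theorem exists_adjustment (r : L → ℕ) (f₀ : L → B) : ∃ f : L → B, (∀ p, f₀ p ≤ f p) ∧
    (∀ p (I : Finset L) (hI : I.Nonempty), p ≤ I.sup' hI id → (∀ j ∈ I, r j < r p) →
      I.inf' hI f ≤ f p) ∧
    ∀ p (P : B → Prop), P ⊥ → (∀ b b', P b → P b' → P (b ⊔ b')) → P (f₀ p) →
      (∀ (I : Finset L) (hI : I.Nonempty), p ≤ I.sup' hI id → (∀ j ∈ I, r j < r p) →
        P (I.inf' hI f)) → P (f p) := by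
  classical
  have := Fintype.ofFinite L
  let G : ∀ p : L, (∀ j, r j < r p → B) → B := fun p rec =>
    f₀ p ⊔ (Finset.univ : Finset (Finset L)).sup fun I =>
      if h : ∃ hI : I.Nonempty, p ≤ I.sup' hI id ∧ ∀ j ∈ I, r j < r p then
        I.attach.inf' (Finset.attach_nonempty_iff.mpr h.1) fun j => rec j.1 (h.2.2 j.1 j.2)
      else ⊥
  let f : L → B := (measure r).wf.fix G
  have hf : ∀ p, f p = f₀ p ⊔ (Finset.univ : Finset (Finset L)).sup fun I =>
      if h : ∃ hI : I.Nonempty, p ≤ I.sup' hI id ∧ ∀ j ∈ I, r j < r p then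
        I.inf' h.1 f
      else ⊥ := by
    intro p
    refine ((measure r).wf.fix_eq G p).trans ?_
    refine congrArg (f₀ p ⊔ ·) (Finset.sup_congr rfl fun I _ => ?_)
    split_ifs with h
    · refine le_antisymm (Finset.le_inf' _ _ fun j hj => ?_) (Finset.le_inf' _ _ fun j _ => ?_)
      · exact Finset.inf'_le (fun j : {x // x ∈ I} => f j.1) (Finset.mem_attach I ⟨j, hj⟩)
      · exact Finset.inf'_le f j.2
    · rfl
  refine ⟨f, fun p => (hf p).ge.trans' le_sup_left, fun p I hI h1 h2 => ?_,
    fun p P h0 hs hb hI => ?_⟩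
  · rw [hf p]
    refine le_sup_of_le_right ((Finset.le_sup (Finset.mem_univ I)).trans' ?_)
    rw [dif_pos ⟨hI, h1, h2⟩]
  · rw [hf p]
    refine hs _ _ hb (Finset.sup_induction h0 (fun b hb b' hb' => hs b b' hb hb') fun I _ => ?_)
    split_ifs with h
    · exact hI I h.1 h.2.1 h.2.2
    · exact h0

variable {A : Type w} [Lattice A] [OrderBot A]

/-- Start from the joins of the second coordinates available above each `p` and adjust along join
covers of smaller rank. Each adjustment stays below `τ`, and together they suffice for the sets `{x
| x ≤ s} × {y | y ≤ F s}` to cover a bi-ideal. -/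
theorem exists_sections_of_satisfiesTJoin (S : Sublattice A) [Finite S] (hS : ⊥ ∈ S)
    (hT : SatisfiesTJoin S) (τ : TensorTerm A B) (hτ : ∀ g ∈ τ.gens, g.1 ∈ S) :
    ∃ f : S → B, Antitone f ∧ (∀ s : S, tens (s : A) (f s) ≤ τ) ∧
      ∀ x y, x ≠ ⊥ → y ≠ ⊥ → tens x y ≤ τ → ∃ s : S, x ≤ s ∧ y ≤ f s := by
  classical
  have := Fintype.ofFinite S
  obtain ⟨r, hr⟩ := hT.exists_rank
  obtain ⟨f, hf1, hf2, hf3⟩ := exists_adjustment r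
    fun p : S => (τ.gens.filter fun g : A × B => (p : A) ≤ g.1).sup Prod.snd
  -- The join of all second coordinates stands in for a top element, which `B` may lack; it is the
  -- value of `F` at `⊥`.
  choose F hF using fun s : S => exists_bounded_inf (τ.gens.sup Prod.snd)
    (Finset.univ.filter fun p : S => SupIrred p ∧ p ≤ s) f
  have hF' : ∀ s y, y ≤ F s ↔ y ≤ τ.gens.sup Prod.snd ∧ ∀ p, SupIrred p → p ≤ s → y ≤ f p := by
    simpa using hF
  have hanti : Antitone F := fun s t hst => (hF' s _).mpr
    ⟨((hF' t _).mp le_rfl).1, fun p hp hps => ((hF' t _).mp le_rfl).2 p hp (hps.trans hst)⟩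
  have hsup : ∀ s t y, y ≤ F s → y ≤ F t → y ≤ F (s ⊔ t) := by
    intro s t y hs ht
    rw [hF'] at hs ht ⊢
    refine ⟨hs.1, fun p hp hpst => ?_⟩
    by_cases hps : p ≤ s
    · exact hs.2 p hp hps
    by_cases hpt : p ≤ t
    · exact ht.2 p hp hpt
    -- The cover `{s, t}` itself need not have smaller rank than `p`; the minimal pair refining it
    -- does, so the adjustment applies.
    obtain ⟨I, hI, hIX⟩ := exists_isMinimalPair hp (X := {s, t}) ⟨s ⊔ t, isLUB_pair, hpst⟩
      (by rintro x (rfl | rfl) <;> assumption)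
    have hne : I.toFinset.Nonempty := Set.toFinset_nonempty.mpr hI.two_le_card.nonempty
    refine (Finset.le_inf' hne f fun j hj => ?_).trans (hf2 p I.toFinset hne ?_ ?_)
    · have hj' := Set.mem_toFinset.mp hj
      obtain ⟨x, rfl | rfl, hjx⟩ := hIX j hj'
      · exact hs.2 j (hI.subset_supIrred j hj') hjx
      · exact ht.2 j (hI.subset_supIrred j hj') hjx
    · exact leJoin_iff.mp hI.le_join _ fun j hj => Finset.le_sup' id (Set.mem_toFinset.mpr hj)
    · exact fun j hj => hr p I hI j (Set.mem_toFinset.mp hj)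
  have hfτ : ∀ p : S, tens (p : A) (f p) ≤ τ := by
    intro p
    induction p using (measure r).wf.induction with
    | _ p ih =>
    refine hf3 p (fun b => tens (p : A) b ≤ τ) (tens_le_of_right_eq_bot rfl τ)
      (fun _ _ => tens_sup_right_le) ?_ fun I hI hpI hrI => ?_
    · refine Finset.sup_induction (p := fun b => tens (p : A) b ≤ τ)
        (tens_le_of_right_eq_bot rfl τ) (fun _ h _ h' => tens_sup_right_le h h') fun g hg => ?_
      obtain ⟨hg, hpg⟩ := Finset.mem_filter.mp hg
      exact (tens_mono hpg le_rfl).trans (TensorTerm.tens_le_of_mem_gens hg)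
    · refine (tens_mono (Subtype.coe_le_coe.mpr hpI) le_rfl).trans ?_
      refine Finset.sup'_induction hI id (p := fun s : S => tens (s : A) (I.inf' hI f) ≤ τ)
        (fun s h t h' => tens_sup_left_le h h') fun j hj => ?_
      exact (tens_mono le_rfl (Finset.inf'_le f hj)).trans (ih j (hrI j hj))
  have hirr : ∀ (y : B) (s : S), (∀ p : S, SupIrred p → p ≤ s → tens (p : A) y ≤ τ) →
      tens (s : A) y ≤ τ := by
    intro y s
    induction s using WellFoundedLT.induction with
    | ind s ih =>
      intro h
      by_cases hs : SupIrred s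
      · exact h s hs le_rfl
      rcases not_supIrred.mp hs with hs | ⟨c, d, rfl, hc, hd⟩
      · exact tens_le_of_left_eq_bot (le_bot_iff.mp (hs (b := ⟨⊥, hS⟩) (bot_le (a := (s : A))))) τ
      · exact tens_sup_left_le (ih c hc fun p hp hpc => h p hp (hpc.trans hc.le))
          (ih d hd fun p hp hpd => h p hp (hpd.trans hd.le))
  refine ⟨F, hanti, fun s => hirr _ s fun p hp hps => ?_, fun x y hx hy h => ?_⟩
  · exact (tens_mono le_rfl (((hF' s _).mp le_rfl).2 p hp hps)).trans (hfτ p)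
  · have hI : IsBiIdeal fun (x : A) (y : B) => ∃ s : S, x ≤ s ∧ y ≤ F s := by
      refine ⟨?_, ?_, ?_⟩
      · rintro a a' b b' ha hb ⟨s, h1, h2⟩
        exact ⟨s, ha.trans h1, hb.trans h2⟩
      · rintro a a' b ⟨s, h1, h2⟩ ⟨t, h3, h4⟩
        exact ⟨s ⊔ t, sup_le_sup h1 h3, hsup s t b h2 h4⟩
      · rintro a b b' ⟨s, h1, h2⟩ ⟨t, h3, h4⟩
        exact ⟨s ⊓ t, le_inf h1 h3, sup_le (h2.trans (hanti inf_le_left))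
          (h4.trans (hanti inf_le_right))⟩
    refine hI.of_tens_le (fun g hg => ⟨⟨g.1, hτ g hg⟩, le_rfl, (hF' _ _).mpr
      ⟨Finset.le_sup (f := Prod.snd) hg, fun p _ hpg => (hf1 p).trans' ?_⟩⟩) hx hy h
    exact Finset.le_sup (f := Prod.snd) (Finset.mem_filter.mpr ⟨hg, hpg⟩)

theorem isLatticeOrder_tensor_of_satisfiesTJoin (hA : IsLocallyFiniteLattice A)
    (hT : ∀ S : Sublattice A, Finite S → SatisfiesTJoin S) :
    IsLatticeOrder (SemilatticeTensor A B) := by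
  classical
  refine isLatticeOrder_tensor_iff.mpr fun σ τ => ?_
  let G : Finset A := insert ⊥ ((σ.gens ∪ τ.gens).image Prod.fst)
  let S : Sublattice A := ⟨latticeClosure (G : Set A),
    isSublattice_latticeClosure.supClosed, isSublattice_latticeClosure.infClosed⟩
  have hGS : ∀ a ∈ G, a ∈ S := fun a ha => subset_latticeClosure (Finset.mem_coe.mpr ha)
  have hfin : Finite S := (hA _ G.finite_toSet).to_subtype
  have := Fintype.ofFinite S
  have hbot : ⊥ ∈ S := hGS ⊥ (Finset.mem_insert_self _ _)
  obtain ⟨f, hf, hf1, hf2⟩ := exists_sections_of_satisfiesTJoin S hbot (hT S hfin) σ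
    fun g hg => hGS _ (Finset.mem_insert_of_mem (Finset.mem_image_of_mem _
      (Finset.mem_union_left _ hg)))
  obtain ⟨k, hk, hk1, hk2⟩ := exists_sections_of_satisfiesTJoin S hbot (hT S hfin) τ
    fun g hg => hGS _ (Finset.mem_insert_of_mem (Finset.mem_image_of_mem _
      (Finset.mem_union_right _ hg)))
  -- If `(a, b)` lies under `(s, f s)` and `(t, k t)`, antitonicity places it under the pair at `s ⊓
  -- t`.
  obtain ⟨ρ, hρ, -⟩ := exists_term_of_finset
    (Finset.univ.image fun s : S => ((s : A), f s ⊓ k s))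
  refine ⟨ρ, fun a b => ?_⟩
  by_cases ha : a = ⊥
  · simp only [tens_le_of_left_eq_bot ha, and_self]
  by_cases hb : b = ⊥
  · simp only [tens_le_of_right_eq_bot hb, and_self]
  refine ⟨fun h => ⟨h.trans ((hρ σ).mpr ?_), h.trans ((hρ τ).mpr ?_)⟩, fun h => ?_⟩
  · intro g hg
    obtain ⟨s, -, rfl⟩ := Finset.mem_image.mp hg
    exact (tens_mono le_rfl inf_le_left).trans (hf1 s)
  · intro g hg
    obtain ⟨s, -, rfl⟩ := Finset.mem_image.mp hg
    exact (tens_mono le_rfl inf_le_right).trans (hk1 s)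
  · obtain ⟨s, hs1, hs2⟩ := hf2 a b ha hb h.1
    obtain ⟨t, ht1, ht2⟩ := hk2 a b ha hb h.2
    refine (tens_mono (le_inf hs1 ht1) (le_inf (hs2.trans (hf inf_le_left))
      (ht2.trans (hk inf_le_right)))).trans
      ((hρ ρ).mp le_rfl _ (Finset.mem_image_of_mem _ (Finset.mem_univ (s ⊓ t))))

end Adjustment

theorem mainTheorem7 (A : Type u) [Lattice A] [OrderBot A] :
    List.TFAE [
      IsAmenableLattice.{u, v} A,
      IsLocallyFiniteLattice A ∧
        ∀ (B : Type v) [Lattice B] [OrderBot B], IsLatticeOrder (SemilatticeTensor A B),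
      IsLocallyFiniteLattice A ∧ IsLatticeOrder (SemilatticeTensor A F3),
      IsLocallyFiniteLattice A ∧ ∀ S : Sublattice A, Finite S → SatisfiesTJoin S] := by
  -- Double filters and `F(3)` live in the lowest universe, while amenability is stated in universe
  -- `v`; lifting bridges the gap.
  have hdown : IsAmenableLattice.{u, v} A → ∀ (B : Type) [Lattice B] [OrderBot B],
      IsLatticeOrder (SemilatticeTensor A B) := fun h B _ _ =>
    isLatticeOrder_tensor_of_orderIso ⟨Equiv.ulift.{v}, Iff.rfl⟩ (h (ULift.{v} B))
  tfae_have 1 → 2 := fun h => ⟨isLocallyFiniteLattice_of_tensor (hdown h), fun B => h B⟩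
  tfae_have 2 → 3 := fun h => ⟨h.1, hdown h.2 F3⟩
  tfae_have 3 → 4 := fun h => ⟨h.1, fun S _ => satisfiesTJoin_of_isLatticeOrder_tensor_F3 h.2 S⟩
  tfae_have 4 → 1 := fun h B _ _ => isLatticeOrder_tensor_of_satisfiesTJoin h.1 h.2
  tfae_finish
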